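/- Let $R$ be a Dedekind domain (fields are allowed). An $R$-lattice of rank $n$ is a finitely generated torsion-free $R$-module of rank $n$, and a quartic $R$-algebra is a commutative unital associative $R$-algebra $Q$ that is an $R$-lattice of rank $4$; write $Q/R$ for the quotient of the $R$-module $Q$ by $R\cdot 1$. A resolvent of $Q$ is a triple $(M,\theta,\phi)$ consisting of an $R$-lattice $M$ of rank $2$, an $R$-linear map $\theta:\Lambda^2M\to\Lambda^3(Q/R)$ and a quadratic map $\phi:Q/R\to M$ such that $$\bar x\wedge \bar y\wedge \overline{xy}=\theta\bigl(\phi(\bar x)\wedge\phi(\bar y)\bigr)\quad\text{in }\Lambda^3(Q/R)\text{ for all }x,y\in Q,$$ where the bar denotes the class in $Q/R$. **Theorem.** Let $\tilde Q$ and $M$ be $R$-lattices of ranks $3$ and $2$ respectively, let $\theta:\Lambda^2M\to\Lambda^3\tilde Q$ be an $R$-linear map, and let $\phi:\tilde Q\to M$ be a quadratic map. Then there is a quartic $R$-algebra $Q$ with an isomorphism of $R$-modules $\iota:Q/R\to\tilde Q$ such that $(M,\theta,\phi)$ is a resolvent of $Q$ when $\tilde Q$ is identified with $Q/R$ along $\iota$,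 that is, $(M,\ \Lambda^3(\iota^{-1})\circ\theta,\ \phi\circ\iota)$ is a resolvent of $Q$. The pair $(Q,\iota)$ is unique up to isomorphism: if $(Q',\iota')$ is another such pair, then there is an isomorphism of $R$-algebras $f:Q\to Q'$ with $\iota'(\overline{f(q)})=\iota(\bar q)$ for all $q\in Q$. -/

import Mathlib

universe u v w x

/-- `M` is an `R`-lattice of rank `n`: a finitely generated torsion-free `R`-module of rank `n`.
Over a domain `R` with fraction field `K`, `Module.finrank R M` is the `K`-dimension of `M ⊗ K`. -/
structure IsLatticeOfRank (R : Type*) [CommRing R] (M : Type*) [AddCommGroup M] [Module R M]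
    (n : ℕ) : Prop where
  finite : Module.Finite R M
  torsionFree : Module.IsTorsionFree R M
  finrank_eq : Module.finrank R M = n

/-- A quartic `R`-algebra: a commutative unital `R`-algebra that is an `R`-lattice of rank `4`. -/
def IsQuarticAlgebra (R : Type*) [CommRing R] (Q : Type*) [CommRing Q] [Algebra R Q] : Prop :=
  IsLatticeOfRank R Q 4

/-- The `R`-module `Q / R`, the quotient of an `R`-algebra `Q` by the submodule `R · 1`. -/
abbrev ModScalars (R : Type*) [CommRing R] (Q : Type*) [CommRing Q] [Algebra R Q] :=
  Q ⧸ LinearMap.range (Algebra.linearMap R Q)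

/-- The class of `q : Q` in `Q / R`. -/
abbrev ModScalars.mk (R : Type*) [CommRing R] {Q : Type*} [CommRing Q] [Algebra R Q] (q : Q) :
    ModScalars R Q :=
  Submodule.Quotient.mk q

/-- `(M, θ, φ)` is a resolvent for the quartic `R`-algebra `Q`: `M` is a rank-`2` lattice and
`x ∧ y ∧ xy = θ (φ x ∧ φ y)` in `Λ³(Q/R)` for all `x, y : Q`.

Both sides are biquadratic in `(x, y)`. A biquadratic map is determined by its values (as a
quadratic map is: its coefficients are values at basis vectors and at sums of two of them), so
equality of values is the same as equality of biquadratic maps, over finite fields as well. -/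
structure IsResolvent (R : Type*) [CommRing R] (Q : Type*) [CommRing Q] [Algebra R Q]
    {M : Type*} [AddCommGroup M] [Module R M]
    (θ : ⋀[R]^2 M →ₗ[R] ⋀[R]^3 (ModScalars R Q))
    (φ : QuadraticMap R (ModScalars R Q) M) : Prop where
  isLattice : IsLatticeOfRank R M 2
  wedge_eq : ∀ x y : Q,
    exteriorPower.ιMulti R 3
        ![ModScalars.mk R x, ModScalars.mk R y, ModScalars.mk R (x * y)] =
      θ (exteriorPower.ιMulti R 2 ![φ (ModScalars.mk R x), φ (ModScalars.mk R y)])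

/-- `Q`, with the identification `e : Q / R ≃ Q'` (`Q'` a fixed module), is a quartic `R`-algebra
for which `(M, θ, φ)`, transported along `e` from `Q'` to `Q / R`, is a resolvent. -/
structure IsQuarticAlgebraWithResolvent {R : Type*} [CommRing R]
    {Q' : Type*} [AddCommGroup Q'] [Module R Q'] {M : Type*} [AddCommGroup M] [Module R M]
    (θ : ⋀[R]^2 M →ₗ[R] ⋀[R]^3 Q') (φ : QuadraticMap R Q' M)
    (Q : Type*) [CommRing Q] [Algebra R Q] (e : ModScalars R Q ≃ₗ[R] Q') : Prop where
  isQuartic : IsQuarticAlgebra R Q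
  isResolvent : IsResolvent R Q
    (exteriorPower.map 3 (e.symm : Q' →ₗ[R] ModScalars R Q) ∘ₗ θ)
    (φ.comp (e : ModScalars R Q →ₗ[R] Q'))

/-!
The theorem is proved by passing to the fraction field `K` of `R`. A lattice over a Dedekind domain
is a direct sum of fractional ideals (`IsLatticeOfRank.exists_coordinates`), so `Q'` becomes
`a₀ ⊕ a₁ ⊕ a₂ ⊆ K³`. The determinant embeds `Λ³ Q'` in `K` (`coordDet_lift_injective`), and the
alternating form `det ∘ θ` on the rank two lattice `M` is decomposable, say `u ∧ v`. With
`A = u ∘ φ` and `B = v ∘ φ`, extended to ternary quadratic forms over `K`, the condition defining a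
resolvent reads `det (x, y, x * y) = A x * B y - A y * B x`.

Over `K`, such an algebra exists and is unique. The condition determines the structure constants
modulo scalars, up to the choice of lifts of the basis vectors of `K³`, which can be normalized;
associativity then determines the scalar components. Conversely, the constants so obtained define
an associative multiplication, by a polynomial identity in the coefficients of `A` and `B`. This
gives `QuarticAlgebra A B` and `QuarticAlgebra.exists_algHom`.

The lattice `R ⊕ a₀ ξ₁ ⊕ a₁ ξ₂ ⊕ a₂ ξ₃` in this algebra is closed under multiplication because the
structure constants are homogeneous for the grading which gives `ξᵢ` the weight of the `i`-th ideal
(`QuarticAlgebra.exists_order`); this is the algebra `Q`. For uniqueness over `R`, a second algebra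
`S` lies in `K ⊗ S`, to which `QuarticAlgebra A B` maps. An element of `Q` and one of `S` over the
same element of `Q'` differ by an element of `K`, which is integral over `R`, hence lies in `R`.
So `Q` and `S` have the same image in `K ⊗ S` (`QuarticAlgebra.exists_algEquiv`).
-/

/-! ### The quartic algebra of a pair of ternary quadratic forms -/

/-- A ternary quadratic form, given by its six coefficients. -/
structure TernaryForm (K : Type*) where
  c11 : K
  c22 : K
  c33 : K
  c12 : K
  c13 : K
  c23 : K

namespace TernaryForm

variable {K : Type*} [CommRing K]

/-- The value of a ternary quadratic form at a vector. -/
def eval (A : TernaryForm K) (v : Fin 3 → K) : K :=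
  A.c11 * (v 0 * v 0) + A.c22 * (v 1 * v 1) + A.c33 * (v 2 * v 2) + A.c12 * (v 0 * v 1)
    + A.c13 * (v 0 * v 2) + A.c23 * (v 1 * v 2)

lemma eval_smul (A : TernaryForm K) (c : K) (v : Fin 3 → K) :
    A.eval (c • v) = c * c * A.eval v := by
  simp only [eval, Pi.smul_apply, smul_eq_mul]
  ring

end TernaryForm

/-- The quartic algebra attached to a pair `(A, B)` of ternary quadratic forms over `K`: the free
module with basis `1, ξ₁, ξ₂, ξ₃`, with the multiplication determined by
`det (x, y, x * y) = A x * B y - A y * B x` modulo scalars, normalized so that `ξ₁ * ξ₂` has no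
`ξ₁`- and `ξ₂`-components and `ξ₁ * ξ₃` has no `ξ₁`-component. -/
@[ext]
structure QuarticAlgebra {K : Type*} (A B : TernaryForm K) where
  x0 : K
  x1 : K
  x2 : K
  x3 : K

namespace QuarticAlgebra

variable {K : Type*} [CommRing K] (A B : TernaryForm K)

/-! The structure constants: `sijk` is the coefficient of `ξₖ` in `ξᵢ * ξⱼ`, and `sij0` the scalar
component of `ξᵢ * ξⱼ`. For `k ≠ 0` they are signed `2 × 2` minors of the coefficient matrix of the
pair `(A, B)`, or sums of two such minors. -/

def s111 : K := (A.c12 * B.c13 - A.c13 * B.c12) + (A.c11 * B.c23 - A.c23 * B.c11)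
def s112 : K := -(A.c11 * B.c13 - A.c13 * B.c11)
def s113 : K := A.c11 * B.c12 - A.c12 * B.c11
def s221 : K := A.c22 * B.c23 - A.c23 * B.c22
def s222 : K := -(A.c22 * B.c13 - A.c13 * B.c22) + (A.c23 * B.c12 - A.c12 * B.c23)
def s223 : K := -(A.c22 * B.c12 - A.c12 * B.c22)
def s331 : K := -(A.c33 * B.c23 - A.c23 * B.c33)
def s332 : K := A.c33 * B.c13 - A.c13 * B.c33
def s333 : K := (A.c33 * B.c12 - A.c12 * B.c33) + (A.c13 * B.c23 - A.c23 * B.c13)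
def s123 : K := A.c11 * B.c22 - A.c22 * B.c11
def s132 : K := A.c33 * B.c11 - A.c11 * B.c33
def s133 : K := A.c11 * B.c23 - A.c23 * B.c11
def s231 : K := A.c22 * B.c33 - A.c33 * B.c22
def s232 : K := A.c33 * B.c12 - A.c12 * B.c33
def s233 : K := -(A.c22 * B.c13 - A.c13 * B.c22)

/-! The scalar components are forced by associativity: comparing the coefficients of `ξₖ` in
`(ξᵢ * ξⱼ) * ξₖ` and `ξᵢ * (ξⱼ * ξₖ)`, for any `k ≠ i`, gives
`sij0 = ∑ₗ (sjkl * slik - sijl * slkk)`. -/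

def s110 : K := s123 A B * s132 A B
  - (s112 A B * s222 A B + s113 A B * s232 A B)
def s220 : K := s123 A B * s231 A B - (s221 A B * s111 A B)
def s330 : K := s132 A B * s231 A B + s133 A B * s331 A B - (s331 A B * s111 A B)
def s120 : K := s231 A B * s113 A B + s232 A B * s123 A B + s233 A B * s133 A B
   - (s123 A B * s333 A B)
def s130 : K := s231 A B * s112 A B + s233 A B * s132 A B
  - (s132 A B * s222 A B + s133 A B * s232 A B)
def s230 : K := s132 A B * s221 A B + s133 A B * s231 A B - (s231 A B * s111 A B)

variable {A B}

instance : Zero (QuarticAlgebra A B) := ⟨⟨0, 0, 0, 0⟩⟩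
instance : One (QuarticAlgebra A B) := ⟨⟨1, 0, 0, 0⟩⟩
instance : Add (QuarticAlgebra A B) :=
  ⟨fun p q => ⟨p.x0 + q.x0, p.x1 + q.x1, p.x2 + q.x2, p.x3 + q.x3⟩⟩
instance : Neg (QuarticAlgebra A B) := ⟨fun p => ⟨-p.x0, -p.x1, -p.x2, -p.x3⟩⟩
instance : Mul (QuarticAlgebra A B) :=
  ⟨fun p q =>
    ⟨p.x0 * q.x0 + p.x1 * q.x1 * s110 A B + p.x2 * q.x2 * s220 A B + p.x3 * q.x3 * s330 A B
        + (p.x1 * q.x2 + p.x2 * q.x1) * s120 A B + (p.x1 * q.x3 + p.x3 * q.x1) * s130 A B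
        + (p.x2 * q.x3 + p.x3 * q.x2) * s230 A B,
      p.x0 * q.x1 + p.x1 * q.x0 + p.x1 * q.x1 * s111 A B + p.x2 * q.x2 * s221 A B
        + p.x3 * q.x3 * s331 A B + (p.x2 * q.x3 + p.x3 * q.x2) * s231 A B,
      p.x0 * q.x2 + p.x2 * q.x0 + p.x1 * q.x1 * s112 A B + p.x2 * q.x2 * s222 A B
        + p.x3 * q.x3 * s332 A B + (p.x1 * q.x3 + p.x3 * q.x1) * s132 A B
        + (p.x2 * q.x3 + p.x3 * q.x2) * s232 A B,
      p.x0 * q.x3 + p.x3 * q.x0 + p.x1 * q.x1 * s113 A B + p.x2 * q.x2 * s223 A B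
        + p.x3 * q.x3 * s333 A B + (p.x1 * q.x2 + p.x2 * q.x1) * s123 A B
        + (p.x1 * q.x3 + p.x3 * q.x1) * s133 A B + (p.x2 * q.x3 + p.x3 * q.x2) * s233 A B⟩⟩

variable (p q : QuarticAlgebra A B)

@[simp] lemma x0_zero : (0 : QuarticAlgebra A B).x0 = 0 := rfl
@[simp] lemma x1_zero : (0 : QuarticAlgebra A B).x1 = 0 := rfl
@[simp] lemma x2_zero : (0 : QuarticAlgebra A B).x2 = 0 := rfl
@[simp] lemma x3_zero : (0 : QuarticAlgebra A B).x3 = 0 := rfl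
@[simp] lemma x0_one : (1 : QuarticAlgebra A B).x0 = 1 := rfl
@[simp] lemma x1_one : (1 : QuarticAlgebra A B).x1 = 0 := rfl
@[simp] lemma x2_one : (1 : QuarticAlgebra A B).x2 = 0 := rfl
@[simp] lemma x3_one : (1 : QuarticAlgebra A B).x3 = 0 := rfl
@[simp] lemma x0_add : (p + q).x0 = p.x0 + q.x0 := rfl
@[simp] lemma x1_add : (p + q).x1 = p.x1 + q.x1 := rfl
@[simp] lemma x2_add : (p + q).x2 = p.x2 + q.x2 := rfl
@[simp] lemma x3_add : (p + q).x3 = p.x3 + q.x3 := rfl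
@[simp] lemma x0_neg : (-p).x0 = -p.x0 := rfl
@[simp] lemma x1_neg : (-p).x1 = -p.x1 := rfl
@[simp] lemma x2_neg : (-p).x2 = -p.x2 := rfl
@[simp] lemma x3_neg : (-p).x3 = -p.x3 := rfl
lemma x0_mul : (p * q).x0 =
    p.x0 * q.x0 + p.x1 * q.x1 * s110 A B + p.x2 * q.x2 * s220 A B + p.x3 * q.x3 * s330 A B
        + (p.x1 * q.x2 + p.x2 * q.x1) * s120 A B + (p.x1 * q.x3 + p.x3 * q.x1) * s130 A B
        + (p.x2 * q.x3 + p.x3 * q.x2) * s230 A B := rfl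
lemma x1_mul : (p * q).x1 =
    p.x0 * q.x1 + p.x1 * q.x0 + p.x1 * q.x1 * s111 A B + p.x2 * q.x2 * s221 A B
        + p.x3 * q.x3 * s331 A B + (p.x2 * q.x3 + p.x3 * q.x2) * s231 A B := rfl
lemma x2_mul : (p * q).x2 =
    p.x0 * q.x2 + p.x2 * q.x0 + p.x1 * q.x1 * s112 A B + p.x2 * q.x2 * s222 A B
        + p.x3 * q.x3 * s332 A B + (p.x1 * q.x3 + p.x3 * q.x1) * s132 A B
        + (p.x2 * q.x3 + p.x3 * q.x2) * s232 A B := rfl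
lemma x3_mul : (p * q).x3 =
    p.x0 * q.x3 + p.x3 * q.x0 + p.x1 * q.x1 * s113 A B + p.x2 * q.x2 * s223 A B
        + p.x3 * q.x3 * s333 A B + (p.x1 * q.x2 + p.x2 * q.x1) * s123 A B
        + (p.x1 * q.x3 + p.x3 * q.x1) * s133 A B + (p.x2 * q.x3 + p.x3 * q.x2) * s233 A B := rfl

set_option maxHeartbeats 1000000 in
/-- Associativity is a polynomial identity in the twelve coefficients of the pair of forms. -/
protected lemma mul_assoc (p q r : QuarticAlgebra A B) : p * q * r = p * (q * r) := by
  ext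
  · simp only [x0_mul, x1_mul, x2_mul, x3_mul, s110, s220, s330, s120, s130, s230]
    simp only [s111, s112, s113, s221, s222, s223, s331, s332, s333, s123, s132, s133, s231,
      s232, s233]
    ring
  · simp only [x0_mul, x1_mul, x2_mul, x3_mul, s110, s220, s330, s120, s130, s230]
    simp only [s111, s112, s113, s221, s222, s223, s331, s332, s333, s123, s132, s133, s231,
      s232, s233]
    ring
  · simp only [x0_mul, x1_mul, x2_mul, x3_mul, s110, s220, s330, s120, s130, s230]
    simp only [s111, s112, s113, s221, s222, s223, s331, s332, s333, s123, s132, s133, s231,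
      s232, s233]
    ring
  · simp only [x0_mul, x1_mul, x2_mul, x3_mul, s110, s220, s330, s120, s130, s230]
    simp only [s111, s112, s113, s221, s222, s223, s331, s332, s333, s123, s132, s133, s231,
      s232, s233]
    ring

instance : CommRing (QuarticAlgebra A B) where
  add_assoc p q r := by ext <;> simp [add_assoc]
  zero_add p := by ext <;> simp
  add_zero p := by ext <;> simp
  nsmul := nsmulRec
  zsmul := zsmulRec
  neg_add_cancel p := by ext <;> simp
  add_comm p q := by ext <;> simp [add_comm]
  left_distrib p q r := by
    ext <;> simp only [x0_mul, x1_mul, x2_mul, x3_mul, x0_add, x1_add, x2_add, x3_add] <;> ring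
  right_distrib p q r := by
    ext <;> simp only [x0_mul, x1_mul, x2_mul, x3_mul, x0_add, x1_add, x2_add, x3_add] <;> ring
  zero_mul p := by ext <;> simp [x0_mul, x1_mul, x2_mul, x3_mul]
  mul_zero p := by ext <;> simp [x0_mul, x1_mul, x2_mul, x3_mul]
  one_mul p := by ext <;> simp [x0_mul, x1_mul, x2_mul, x3_mul]
  mul_one p := by ext <;> simp [x0_mul, x1_mul, x2_mul, x3_mul]
  mul_comm p q := by ext <;> simp only [x0_mul, x1_mul, x2_mul, x3_mul] <;> ring
  mul_assoc := QuarticAlgebra.mul_assoc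

variable {R : Type*} [CommRing R] [Algebra R K]

instance : Algebra R (QuarticAlgebra A B) where
  smul r p := ⟨r • p.x0, r • p.x1, r • p.x2, r • p.x3⟩
  algebraMap :=
    { toFun := fun r => ⟨algebraMap R K r, 0, 0, 0⟩
      map_one' := by ext <;> simp
      map_zero' := by ext <;> simp
      map_add' := fun r s => by ext <;> simp
      map_mul' := fun r s => by ext <;> simp [x0_mul, x1_mul, x2_mul, x3_mul] }
  commutes' r p := mul_comm _ _
  smul_def' r p := by
    change (⟨r • p.x0, r • p.x1, r • p.x2, r • p.x3⟩ : QuarticAlgebra A B) =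
      (⟨algebraMap R K r, 0, 0, 0⟩ : QuarticAlgebra A B) * p
    ext <;> simp [x0_mul, x1_mul, x2_mul, x3_mul, Algebra.smul_def]

@[simp] lemma x0_smul (r : R) : (r • p).x0 = r • p.x0 := rfl
@[simp] lemma x1_smul (r : R) : (r • p).x1 = r • p.x1 := rfl
@[simp] lemma x2_smul (r : R) : (r • p).x2 = r • p.x2 := rfl
@[simp] lemma x3_smul (r : R) : (r • p).x3 = r • p.x3 := rfl
@[simp] lemma x0_algebraMap (r : R) :
    (algebraMap R (QuarticAlgebra A B) r).x0 = algebraMap R K r := rfl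
@[simp] lemma x1_algebraMap (r : R) : (algebraMap R (QuarticAlgebra A B) r).x1 = 0 := rfl
@[simp] lemma x2_algebraMap (r : R) : (algebraMap R (QuarticAlgebra A B) r).x2 = 0 := rfl
@[simp] lemma x3_algebraMap (r : R) : (algebraMap R (QuarticAlgebra A B) r).x3 = 0 := rfl

instance : IsScalarTower R K (QuarticAlgebra A B) where
  smul_assoc r k p := by ext <;> simp

/-- The coordinates of an element modulo scalars. -/
def coords : QuarticAlgebra A B →ₗ[K] (Fin 3 → K) where
  toFun p := ![p.x1, p.x2, p.x3]
  map_add' p q := by ext i; fin_cases i <;> simp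
  map_smul' c p := by ext i; fin_cases i <;> simp

lemma coords_apply : coords p = ![p.x1, p.x2, p.x3] := rfl

/-- The resolvent identity for the algebra of a pair of forms. -/
lemma det_coords_mul (p q : QuarticAlgebra A B) :
    (Matrix.of ![coords p, coords q, coords (p * q)]).det =
      A.eval (coords p) * B.eval (coords q) - A.eval (coords q) * B.eval (coords p) := by
  simp only [coords_apply, Matrix.det_fin_three, TernaryForm.eval, x1_mul, x2_mul, x3_mul]
  simp [s111, s112, s113, s221, s222, s223, s331, s332, s333, s123, s132, s133, s231,
        s232, s233]
  ring

/-- In an algebra `T` with `T / K = K³` satisfying the resolvent identity, the unit vectors have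
lifts which multiply modulo scalars like the basis of `QuarticAlgebra A B`. -/
lemma exists_lifts {T : Type*} [CommRing T] [Algebra K T] (π : T →ₗ[K] (Fin 3 → K))
    (hone : π 1 = 0) (hsurj : Function.Surjective π)
    (hdet : ∀ x y, (Matrix.of ![π x, π y, π (x * y)]).det =
      A.eval (π x) * B.eval (π y) - A.eval (π y) * B.eval (π x)) :
    ∃ ξ1 ξ2 ξ3 : T, π ξ1 = ![1, 0, 0] ∧ π ξ2 = ![0, 1, 0] ∧ π ξ3 = ![0, 0, 1] ∧
      π (ξ1 * ξ1) = ![s111 A B, s112 A B, s113 A B] ∧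
      π (ξ2 * ξ2) = ![s221 A B, s222 A B, s223 A B] ∧
      π (ξ3 * ξ3) = ![s331 A B, s332 A B, s333 A B] ∧
      π (ξ1 * ξ2) = ![0, 0, s123 A B] ∧
      π (ξ1 * ξ3) = ![0, s132 A B, s133 A B] ∧
      π (ξ2 * ξ3) = ![s231 A B, s232 A B, s233 A B] := by
  have hpa : ∀ k, π (algebraMap K T k) = 0 := fun k => by
    rw [Algebra.algebraMap_eq_smul_one, map_smul, hone, smul_zero]
  have hpm : ∀ k t, π (algebraMap K T k * t) = k • π t := fun k t => by
    rw [← Algebra.smul_def, map_smul]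
  obtain ⟨η1, h1⟩ := hsurj ![1, 0, 0]
  obtain ⟨η2, h2⟩ := hsurj ![0, 1, 0]
  obtain ⟨η3, h3⟩ := hsurj ![0, 0, 1]
  -- Changing the lift `ηᵢ` by a scalar `c` changes the `ηⱼ`-component of `ηᵢ * ηⱼ` by `c`.
  obtain ⟨ξ1, ξ2, ξ3, e1, e2, e3, n120, n121, n130⟩ : ∃ ξ1 ξ2 ξ3 : T, π ξ1 = ![1, 0, 0] ∧
      π ξ2 = ![0, 1, 0] ∧ π ξ3 = ![0, 0, 1] ∧ π (ξ1 * ξ2) 0 = 0 ∧ π (ξ1 * ξ2) 1 = 0 ∧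
      π (ξ1 * ξ3) 0 = 0 := by
    have key : ∀ (a b : K) (s t : T), π ((s - algebraMap K T a) * (t - algebraMap K T b)) =
        π (s * t) - a • π t - b • π s := fun a b s t => by
      have : (s - algebraMap K T a) * (t - algebraMap K T b) =
          s * t - algebraMap K T a * t - algebraMap K T b * s + algebraMap K T (a * b) := by
        rw [map_mul]; ring
      rw [this, map_add, map_sub, map_sub, hpm, hpm, hpa, add_zero]
    refine ⟨η1 - algebraMap K T (π (η1 * η2) 1), η2 - algebraMap K T (π (η1 * η2) 0),
      η3 - algebraMap K T (π (η1 * η3) 0), ?_, ?_, ?_, ?_, ?_, ?_⟩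
    · rw [map_sub, hpa, h1, sub_zero]
    · rw [map_sub, hpa, h2, sub_zero]
    · rw [map_sub, hpa, h3, sub_zero]
    all_goals
      rw [key]
      simp only [h1, h2, h3, Pi.sub_apply, Pi.smul_apply, smul_eq_mul]
      simp
  -- The determinant identity in coordinates.
  have hg : ∀ a1 a2 a3 b1 b2 b3 : K, ∀ u : Fin 3 → K,
      u = (a1 * b1) • π (ξ1 * ξ1) + (a2 * b2) • π (ξ2 * ξ2) + (a3 * b3) • π (ξ3 * ξ3) +
        (a1 * b2 + a2 * b1) • π (ξ1 * ξ2) + (a1 * b3 + a3 * b1) • π (ξ1 * ξ3) +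
        (a2 * b3 + a3 * b2) • π (ξ2 * ξ3) →
      (a2 * b3 - a3 * b2) * u 0 - (a1 * b3 - a3 * b1) * u 1 + (a1 * b2 - a2 * b1) * u 2 =
      A.eval ![a1, a2, a3] * B.eval ![b1, b2, b3] -
        A.eval ![b1, b2, b3] * B.eval ![a1, a2, a3] := by
    intro a1 a2 a3 b1 b2 b3 u hu
    have hx : ∀ a1 a2 a3 : K, π (a1 • ξ1 + a2 • ξ2 + a3 • ξ3) = ![a1, a2, a3] := by
      intro a1 a2 a3
      rw [map_add, map_add, map_smul, map_smul, map_smul, e1, e2, e3]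
      ext i; fin_cases i <;> simp
    have hxy : π ((a1 • ξ1 + a2 • ξ2 + a3 • ξ3) * (b1 • ξ1 + b2 • ξ2 + b3 • ξ3)) = u := by
      rw [hu]
      simp only [← map_smul, ← map_add]
      congr 1
      simp only [Algebra.smul_def, map_add, map_mul]
      ring
    have := hdet (a1 • ξ1 + a2 • ξ2 + a3 • ξ3) (b1 • ξ1 + b2 • ξ2 + b3 • ξ3)
    rw [hx, hx, hxy, Matrix.det_fin_three] at this
    rw [← this]
    simp
    ring
  simp only [TernaryForm.eval] at hg
  -- The coefficients of the biquadratic identity are combinations of its values at `0`-`1` vectors.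
  have k12 := hg 1 0 0 0 1 0 _ rfl
  have k13 := hg 1 0 0 0 0 1 _ rfl
  have k23 := hg 0 1 0 0 0 1 _ rfl
  have k1_12 := hg 1 0 0 1 1 0 _ rfl
  have k1_13 := hg 1 0 0 1 0 1 _ rfl
  have k1_23 := hg 1 0 0 0 1 1 _ rfl
  have k2_12 := hg 0 1 0 1 1 0 _ rfl
  have k2_13 := hg 0 1 0 1 0 1 _ rfl
  have k2_23 := hg 0 1 0 0 1 1 _ rfl
  have k3_12 := hg 0 0 1 1 1 0 _ rfl
  have k3_13 := hg 0 0 1 1 0 1 _ rfl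
  have k3_23 := hg 0 0 1 0 1 1 _ rfl
  have k12_13 := hg 1 1 0 1 0 1 _ rfl
  have k12_23 := hg 1 1 0 0 1 1 _ rfl
  have k13_23 := hg 1 0 1 0 1 1 _ rfl
  simp [n120, n121, n130] at k12 k13 k23 k1_12 k1_13 k1_23 k2_12 k2_13 k2_23 k3_12
  simp [n120, n121, n130] at k3_13 k3_23 k12_13 k12_23 k13_23
  have g123 : π (ξ1 * ξ2) 2 = s123 A B := by rw [s123]; linear_combination k12
  have g132 : π (ξ1 * ξ3) 1 = s132 A B := by rw [s132]; linear_combination -k13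
  have g231 : π (ξ2 * ξ3) 0 = s231 A B := by rw [s231]; linear_combination k23
  have g113 : π (ξ1 * ξ1) 2 = s113 A B := by rw [s113]; linear_combination k1_12 - k12
  have g112 : π (ξ1 * ξ1) 1 = s112 A B := by rw [s112]; linear_combination k13 - k1_13
  have g133 : π (ξ1 * ξ3) 2 = s133 A B := by rw [s133]; linear_combination k1_23 - k12 - k13
  have g223 : π (ξ2 * ξ2) 2 = s223 A B := by rw [s223]; linear_combination -k2_12 - k12
  have g221 : π (ξ2 * ξ2) 0 = s221 A B := by rw [s221]; linear_combination k2_23 - k23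
  have g233 : π (ξ2 * ξ3) 2 = s233 A B := by rw [s233]; linear_combination -k2_13 - k12 + k23
  have g331 : π (ξ3 * ξ3) 0 = s331 A B := by rw [s331]; linear_combination -k3_23 - k23
  have g332 : π (ξ3 * ξ3) 1 = s332 A B := by rw [s332]; linear_combination k3_13 + k13
  have g232 : π (ξ2 * ξ3) 1 = s232 A B := by rw [s232]; linear_combination k3_12 + k13 + k23
  have g111 : π (ξ1 * ξ1) 0 = s111 A B := by
    rw [g123, g132, g231, g113, g112, g133, g233, g232] at k12_13
    simp only [s111, s123, s132, s231, s113, s112, s133, s233, s232] at k12_13 ⊢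
    linear_combination k12_13
  have g222 : π (ξ2 * ξ2) 1 = s222 A B := by
    rw [g123, g132, g231, g223, g221, g133, g233, g232] at k12_23
    simp only [s222, s123, s132, s231, s223, s221, s133, s233, s232] at k12_23 ⊢
    linear_combination -k12_23
  have g333 : π (ξ3 * ξ3) 2 = s333 A B := by
    rw [g123, g132, g231, g331, g332, g133, g233, g232] at k13_23
    simp only [s333, s123, s132, s231, s331, s332, s133, s233, s232] at k13_23 ⊢
    linear_combination k13_23
  refine ⟨ξ1, ξ2, ξ3, e1, e2, e3, ?_, ?_, ?_, ?_, ?_, ?_⟩ <;> ext i <;> fin_cases i <;>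
    assumption

/-- Uniqueness over `K`: an algebra extending `K³` by scalars and satisfying the resolvent identity
for `(A, B)` receives a map from `QuarticAlgebra A B` which is the identity on `K³`. -/
theorem exists_algHom {T : Type*} [CommRing T] [Algebra K T] (π : T →ₗ[K] (Fin 3 → K))
    (hker : ∀ t, π t = 0 → ∃ k, algebraMap K T k = t) (hone : π 1 = 0)
    (hsurj : Function.Surjective π)
    (hdet : ∀ x y, (Matrix.of ![π x, π y, π (x * y)]).det =
      A.eval (π x) * B.eval (π y) - A.eval (π y) * B.eval (π x)) :
    ∃ ψ : QuarticAlgebra A B →ₐ[K] T, ∀ p, π (ψ p) = coords p := by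
  obtain ⟨ξ1, ξ2, ξ3, e1, e2, e3, g11, g22, g33, g12, g13, g23⟩ := exists_lifts π hone hsurj hdet
  have hpa : ∀ k, π (algebraMap K T k) = 0 := fun k => by
    rw [Algebra.algebraMap_eq_smul_one, map_smul, hone, smul_zero]
  have hpm : ∀ k t, π (algebraMap K T k * t) = k • π t := fun k t => by
    rw [← Algebra.smul_def, map_smul]
  have hprod : ∀ (t : T) (a b c : K), π t = ![a, b, c] →
      ∃ z : K, t = algebraMap K T z + algebraMap K T a * ξ1 + algebraMap K T b * ξ2 +
        algebraMap K T c * ξ3 := by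
    intro t a b c ht
    obtain ⟨z, hz⟩ := hker (t - (a • ξ1 + b • ξ2 + c • ξ3)) (by
      rw [map_sub, map_add, map_add, map_smul, map_smul, map_smul, e1, e2, e3, ht]
      ext i; fin_cases i <;> simp)
    refine ⟨z, ?_⟩
    rw [hz]
    simp only [Algebra.smul_def]
    ring
  -- The scalar components `zij` of the products are determined by associativity.
  obtain ⟨z11, r11⟩ := hprod _ _ _ _ g11
  obtain ⟨z22, r22⟩ := hprod _ _ _ _ g22
  obtain ⟨z33, r33⟩ := hprod _ _ _ _ g33
  obtain ⟨z12, r12⟩ := hprod _ _ _ _ g12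
  obtain ⟨z13, r13⟩ := hprod _ _ _ _ g13
  obtain ⟨z23, r23⟩ := hprod _ _ _ _ g23
  have hassoc : ∀ (x y z : T) (c0 c1 c2 c3 d0 d1 d2 d3 : K),
      x * y = algebraMap K T c0 + algebraMap K T c1 * ξ1 + algebraMap K T c2 * ξ2 +
        algebraMap K T c3 * ξ3 →
      y * z = algebraMap K T d0 + algebraMap K T d1 * ξ1 + algebraMap K T d2 * ξ2 +
        algebraMap K T d3 * ξ3 →
      c0 • π z + c1 • π (ξ1 * z) + c2 • π (ξ2 * z) + c3 • π (ξ3 * z) =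
        d0 • π x + d1 • π (ξ1 * x) + d2 • π (ξ2 * x) + d3 • π (ξ3 * x) := by
    intro x y z c0 c1 c2 c3 d0 d1 d2 d3 hxy hyz
    simp only [← map_smul, ← map_add]
    congr 1
    simp only [Algebra.smul_def]
    linear_combination x * hyz - z * hxy
  have comm21 := mul_comm ξ2 ξ1
  have comm31 := mul_comm ξ3 ξ1
  have comm32 := mul_comm ξ3 ξ2
  have h11 : z11 = s110 A B := by
    have := congrFun (hassoc _ _ _ _ _ _ _ _ _ _ _ r11 r12) 1
    simp [e1, e2, g11, g22, g12, g13, g23, comm21, comm31, comm32] at this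
    rw [s110]
    linear_combination this
  have h22 : z22 = s220 A B := by
    have := congrFun (hassoc _ _ _ _ _ _ _ _ _ _ _ r22 (comm21.trans r12)) 0
    simp [e1, e2, g11, g22, g12, g13, g23, comm21, comm31, comm32] at this
    rw [s220]
    linear_combination this
  have h33 : z33 = s330 A B := by
    have := congrFun (hassoc _ _ _ _ _ _ _ _ _ _ _ r33 (comm31.trans r13)) 0
    simp [e1, e3, g11, g33, g12, g13, g23, comm21, comm31] at this
    rw [s330]
    linear_combination this
  have h12 : z12 = s120 A B := by
    have := congrFun (hassoc _ _ _ _ _ _ _ _ _ _ _ r12 r23) 2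
    simp [e1, e3, g11, g33, g12, g13, g23, comm21, comm31] at this
    rw [s120]
    linear_combination this
  have h13 : z13 = s130 A B := by
    have := congrFun (hassoc _ _ _ _ _ _ _ _ _ _ _ r13 (comm32.trans r23)) 1
    simp [e1, e2, g11, g22, g12, g13, g23, comm21, comm31, comm32] at this
    rw [s130]
    linear_combination this
  have h23 : z23 = s230 A B := by
    have := congrFun (hassoc _ _ _ _ _ _ _ _ _ _ _ r23 (comm31.trans r13)) 0
    simp [e1, e2, g11, g22, g12, g13, g23, comm21, comm31, comm32] at this
    rw [s230]
    linear_combination this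
  subst h11 h22 h33 h12 h13 h23
  simp only [map_zero, zero_mul, add_zero] at r12 r13
  refine ⟨
    { toFun := fun p => algebraMap K T p.x0 + algebraMap K T p.x1 * ξ1 +
        algebraMap K T p.x2 * ξ2 + algebraMap K T p.x3 * ξ3
      map_one' := by simp
      map_zero' := by simp
      map_add' := fun p q => by simp only [x0_add, x1_add, x2_add, x3_add, map_add]; ring
      map_mul' := fun p q => ?_
      commutes' := fun k => by simp }, fun p => ?_⟩
  · simp only [x0_mul, x1_mul, x2_mul, x3_mul, map_add, map_mul]
    linear_combination -algebraMap K T p.x1 * algebraMap K T q.x1 * r11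
      - algebraMap K T p.x2 * algebraMap K T q.x2 * r22
      - algebraMap K T p.x3 * algebraMap K T q.x3 * r33
      - (algebraMap K T p.x1 * algebraMap K T q.x2 + algebraMap K T p.x2 * algebraMap K T q.x1)
        * r12
      - (algebraMap K T p.x1 * algebraMap K T q.x3 + algebraMap K T p.x3 * algebraMap K T q.x1)
        * r13
      - (algebraMap K T p.x2 * algebraMap K T q.x3 + algebraMap K T p.x3 * algebraMap K T q.x2)
        * r23
  · change π (_ + _) = _
    rw [map_add, map_add, map_add, hpa, hpm, hpm, hpm, e1, e2, e3, coords_apply]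
    ext i; fin_cases i <;> simp

end QuarticAlgebra

open scoped nonZeroDivisors

/-! ### Lattices over a Dedekind domain -/

lemma IsLatticeOfRank.projective {R : Type*} [CommRing R] [IsDedekindDomain R] {P : Type*}
    [AddCommGroup P] [Module R P] {n : ℕ} (h : IsLatticeOfRank R P n) : Module.Projective R P := by
  have := h.finite
  have := h.torsionFree
  have := Module.finitePresentation_of_finite R P
  exact Module.Flat.projective_of_finitePresentation

/-- A lattice over a Dedekind domain is a direct sum of fractional ideals, each of which may be
taken to contain `1`. The kernel of a nonzero functional splits off as its image is projective. -/
theorem IsLatticeOfRank.exists_coordinates {R : Type*} [CommRing R] [IsDedekindDomain R]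
    (K : Type*) [Field K] [Algebra R K] [IsFractionRing R K] {n : ℕ} {P : Type*}
    [AddCommGroup P] [Module R P] (h : IsLatticeOfRank R P n) :
    ∃ (j : P →ₗ[R] (Fin n → K)) (a : Fin n → FractionalIdeal R⁰ K), Function.Injective j ∧
      (∀ i, (1 : K) ∈ a i) ∧ ∀ v, v ∈ LinearMap.range j ↔ ∀ i, v i ∈ a i := by
  induction n generalizing P with
  | zero =>
    have := h.finite
    have := h.torsionFree
    have : Subsingleton P := by
      by_contra hP
      have := not_subsingleton_iff_nontrivial.mp hP
      have := Module.finrank_pos (R := R) (M := P)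
      rw [h.finrank_eq] at this
      exact this.false
    exact ⟨0, fun _ => 0, fun _ _ _ => Subsingleton.elim _ _, fun i => i.elim0,
      fun v => ⟨fun _ i => i.elim0, fun _ => ⟨0, Subsingleton.elim _ _⟩⟩⟩
  | succ n ih =>
    have := h.finite
    have := h.torsionFree
    have := h.projective
    have : Nontrivial P := Module.nontrivial_of_finrank_pos (R := R) (by rw [h.finrank_eq]; omega)
    obtain ⟨x, hx⟩ := exists_ne (0 : P)
    obtain ⟨f, hf⟩ : ∃ f : P →ₗ[R] R, f x ≠ 0 := by
      by_contra! hcon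
      exact hx ((Module.forall_dual_apply_eq_zero_iff R x).mp hcon)
    set c := f x with hc
    have hcK : algebraMap R K c ≠ 0 := by simpa using hf
    -- The image of `f` is a nonzero ideal, hence projective of rank one, and `f` splits over it.
    have hI : IsLatticeOfRank R (LinearMap.range f) 1 := by
      refine ⟨inferInstance, inferInstance, le_antisymm ?_ ?_⟩
      · simpa using Submodule.finrank_le (LinearMap.range f)
      · have : Nontrivial (LinearMap.range f) := 
          ⟨⟨c, x, rfl⟩, 0, fun h0 => hf (congrArg Subtype.val h0)⟩
        exact Module.finrank_pos
    have := hI.projective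
    obtain ⟨σ, hσ⟩ := Module.projective_lifting_property f.rangeRestrict LinearMap.id
      f.surjective_rangeRestrict
    have hσ' : ∀ i, f (σ i) = i := fun i => congrArg Subtype.val (LinearMap.congr_fun hσ i)
    have hN : IsLatticeOfRank R (LinearMap.ker f) n := by
      refine ⟨inferInstance, inferInstance, ?_⟩
      have h1 := Submodule.finrank_quotient_add_finrank (LinearMap.ker f)
      rw [f.quotKerEquivRange.finrank_eq, hI.finrank_eq, h.finrank_eq] at h1
      omega
    obtain ⟨j, a, hj, ha, hr⟩ := ih hN
    let p : P →ₗ[R] LinearMap.ker f :=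
      (LinearMap.id - σ ∘ₗ f.rangeRestrict).codRestrict (LinearMap.ker f) (fun y => by
        simp [hσ'])
    have hp : ∀ y, (p y : P) = y - σ (f.rangeRestrict y) := fun y => rfl
    let j' : P →ₗ[R] (Fin (n + 1) → K) :=
      { toFun := fun y => Fin.cons ((algebraMap R K c)⁻¹ * algebraMap R K (f y)) (j (p y))
        map_add' := fun y z => by
          ext i; refine Fin.cases ?_ (fun i => ?_) i <;> simp [mul_add]
        map_smul' := fun r y => by
          ext i; refine Fin.cases ?_ (fun i => ?_) i <;> simp [Algebra.smul_def, mul_left_comm] }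
    have hj0 : ∀ y, j' y 0 = (algebraMap R K c)⁻¹ * algebraMap R K (f y) := fun y => rfl
    have hjs : ∀ y (i : Fin n), j' y i.succ = j (p y) i := fun y i => rfl
    refine ⟨j', Fin.cons (FractionalIdeal.spanSingleton R⁰ (algebraMap R K c)⁻¹ *
      ((LinearMap.range f : Ideal R) : FractionalIdeal R⁰ K)) a, ?_, ?_, ?_⟩
    · rw [injective_iff_map_eq_zero]
      intro y hy
      have h0 := congrFun hy 0
      rw [hj0] at h0
      have hfy : f y = 0 := by simpa [hcK, hf] using h0
      have hpy : p y = 0 := hj (by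
        rw [map_zero]
        ext i
        simpa [hjs] using congrFun hy i.succ)
      have h1 := hp y
      rw [hpy, show f.rangeRestrict y = 0 from Subtype.ext hfy, map_zero, sub_zero] at h1
      exact h1.symm
    · refine Fin.cases ?_ (fun i => by simpa using ha i)
      rw [Fin.cons_zero, FractionalIdeal.mem_singleton_mul]
      exact ⟨algebraMap R K c, (FractionalIdeal.mem_coeIdeal _).mpr ⟨c, ⟨x, rfl⟩, rfl⟩,
        (inv_mul_cancel₀ hcK).symm⟩
    · intro v
      constructor
      · rintro ⟨y, rfl⟩
        refine Fin.cases ?_ (fun i => ?_)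
        · rw [Fin.cons_zero, FractionalIdeal.mem_singleton_mul]
          exact ⟨algebraMap R K (f y), (FractionalIdeal.mem_coeIdeal _).mpr ⟨f y, ⟨y, rfl⟩, rfl⟩,
            rfl⟩
        · rw [Fin.cons_succ, hjs]
          exact (hr _).mp ⟨p y, rfl⟩ i
      · intro hv
        have h0 := hv 0
        rw [Fin.cons_zero, FractionalIdeal.mem_singleton_mul] at h0
        obtain ⟨_, hb, hv0⟩ := h0
        obtain ⟨b, hbf, rfl⟩ := (FractionalIdeal.mem_coeIdeal _).mp hb
        obtain ⟨m, hm⟩ := (hr (fun i => v i.succ)).mpr (fun i => by simpa using hv i.succ)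
        have hf' : f (m + σ ⟨b, hbf⟩) = b := by
          rw [map_add, hσ', LinearMap.mem_ker.mp m.2, zero_add]
        refine ⟨m + σ ⟨b, hbf⟩, ?_⟩
        ext i
        refine Fin.cases ?_ (fun i => ?_) i
        · rw [hj0, hf', hv0]
        · rw [hjs, show p (m + σ ⟨b, hbf⟩) = m from Subtype.ext ?_, hm]
          rw [hp, show f.rangeRestrict (m + σ ⟨b, hbf⟩) = ⟨b, hbf⟩ from Subtype.ext hf',
            add_sub_cancel_right]

section Expansion

variable {R : Type*} [CommRing R] {K : Type*} [Field K] [Algebra R K] [IsFractionRing R K]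
  {n : ℕ} {P : Type*} [AddCommGroup P] [Module R P] {j : P →ₗ[R] (Fin n → K)}

/-- Denominators can be cleared: a nonzero multiple of any element is an `R`-combination of the
elements with unit coordinate vectors. -/
lemma exists_smul_eq_sum (hj : Function.Injective j) {w : Fin n → P}
    (hw : ∀ i, j (w i) = Pi.single i 1) (x : P) :
    ∃ (d : R⁰) (r : Fin n → R), (d : R) • x = ∑ i, r i • w i ∧
      ∀ i, algebraMap R K (r i) = algebraMap R K d * j x i := by
  obtain ⟨d, hd⟩ := IsLocalization.exist_integer_multiples_of_finite R⁰ (j x)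
  choose r hr using hd
  simp only [Algebra.smul_def] at hr
  refine ⟨d, r, hj ?_, hr⟩
  ext i
  simp [hw, Finset.sum_apply, Pi.single_apply, Algebra.smul_def, hr]

end Expansion

/-! ### Determinants and forms in coordinates -/

section CoordDet

variable {R : Type*} [CommRing R] {K : Type*} [Field K] [Algebra R K]
  {n : ℕ} {P : Type*} [AddCommGroup P] [Module R P]

/-- The determinant of the coordinate vectors of `n` elements, as an alternating map. -/
def coordDet (j : P →ₗ[R] (Fin n → K)) : P [⋀^Fin n]→ₗ[R] K :=
  AlternatingMap.compLinearMap
    { MultilinearMap.restrictScalars R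
        (Matrix.detRowAlternating (n := Fin n) (R := K)).toMultilinearMap with
      map_eq_zero_of_eq' := fun v _ _ h hij =>
        (Matrix.detRowAlternating (n := Fin n) (R := K)).map_eq_zero_of_eq v h hij } j

lemma coordDet_apply (j : P →ₗ[R] (Fin n → K)) (v : Fin n → P) :
    coordDet j v = (Matrix.of fun i => j (v i)).det := rfl

variable [IsDomain R] [IsFractionRing R K] {j : P →ₗ[R] (Fin n → K)}

/-- An alternating map in `n` variables on a module of rank `n` is a multiple of the determinant. -/
lemma AlternatingMap.eq_coordDet_smul (hj : Function.Injective j) {w : Fin n → P}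
    (hw : ∀ i, j (w i) = Pi.single i 1) {V : Type*} [AddCommGroup V] [Module R V] [Module K V]
    [IsScalarTower R K V] (f : P [⋀^Fin n]→ₗ[R] V) (v : Fin n → P) :
    f v = coordDet j v • f w := by
  choose d r hd hr using fun i => exists_smul_eq_sum hj hw (v i)
  let b := Pi.basisFun R (Fin n)
  let L : (Fin n → R) →ₗ[R] P := Fintype.linearCombination R w
  have hL : ∀ i, L (b i) = w i := fun i => by simp [L, b, Fintype.linearCombination_apply_single]
  have hext : f.compLinearMap L =
      (LinearMap.toSpanSingleton R V (f w)).compAlternatingMap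
        (Matrix.detRowAlternating (n := Fin n) (R := R)) := by
    refine Module.Basis.ext_alternating b fun i hi => ?_
    let s : Equiv.Perm (Fin n) := Equiv.ofBijective i (Finite.injective_iff_bijective.1 hi)
    have h1 : (fun k => L (b (i k))) = w ∘ s := funext fun k => hL _
    have h2 : (fun k => b (i k)) = (fun k => b k) ∘ s := rfl
    have h3 : Matrix.detRowAlternating (fun k => b k) = (1 : R) := by
      change Matrix.det (Matrix.of fun k => b k) = 1
      convert Matrix.det_one (n := Fin n) (R := R)
      ext k l
      simp [b, Matrix.one_apply, Pi.single_apply, eq_comm]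
    rw [AlternatingMap.compLinearMap_apply, LinearMap.compAlternatingMap_apply, h1, h2,
      AlternatingMap.map_perm, AlternatingMap.map_perm, h3, LinearMap.toSpanSingleton_apply,
      smul_assoc, one_smul]
  have hLr : ∀ i, L (r i) = (d i : R) • v i := fun i => by
    rw [hd, Fintype.linearCombination_apply]
  have h := congrArg (fun g => g r) hext
  simp only [AlternatingMap.compLinearMap_apply, LinearMap.compAlternatingMap_apply,
    LinearMap.toSpanSingleton_apply, hLr] at h
  change _ = (Matrix.of r).det • f w at h
  have hs := f.toMultilinearMap.map_smul_univ (fun i => (d i : R)) v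
  simp only [AlternatingMap.coe_multilinearMap] at hs
  have hdet : algebraMap R K (Matrix.of r).det =
      algebraMap R K (∏ i, (d i : R)) * coordDet j v := by
    rw [coordDet_apply, RingHom.map_det, map_prod, ← Matrix.det_mul_column]
    congr 1
    ext i k
    exact hr i k
  have hd0 : algebraMap R K (∏ i, (d i : R)) ≠ 0 := by
    rw [map_prod]
    exact Finset.prod_ne_zero_iff.mpr fun i _ =>
      IsFractionRing.to_map_ne_zero_of_mem_nonZeroDivisors (d i).2
  refine smul_right_injective V hd0 ?_
  simp only
  rw [algebraMap_smul, ← hs, h, smul_smul, ← hdet, algebraMap_smul]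

/-- The top exterior power of a projective module with coordinates embeds in `K`
by the determinant: it is torsion-free, and generically of rank one. -/
lemma coordDet_lift_injective [Module.Projective R P] [Module.Finite R P]
    (hj : Function.Injective j) {w : Fin n → P} (hw : ∀ i, j (w i) = Pi.single i 1) :
    Function.Injective (exteriorPower.alternatingMapLinearEquiv (coordDet j)) := by
  have hflat : Module.Flat R (⋀[R]^n P) := by
    obtain ⟨m, p, i, -, -, hpi⟩ := Module.Finite.exists_comp_eq_id_of_projective R P
    have : Module.Projective R (⋀[R]^n P) :=
      Module.Projective.of_split (exteriorPower.map n i) (exteriorPower.map n p) (by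
        rw [← exteriorPower.map_comp, hpi, exteriorPower.map_id])
    infer_instance
  -- After extension of scalars to `K`, every element is its determinant times `w₁ ∧ ⋯ ∧ wₙ`.
  let ι := TensorProduct.mk R K (⋀[R]^n P) 1
  have hι : Function.Injective ι := fun x y hxy => by
    apply (TensorProduct.lid R (⋀[R]^n P)).symm.injective
    apply Module.Flat.rTensor_preserves_injective_linearMap (M := ⋀[R]^n P)
      (Algebra.linearMap R K) (FaithfulSMul.algebraMap_injective R K)
    simpa [ι] using hxy
  have hfac : ι = (LinearMap.toSpanSingleton K _ (ι (exteriorPower.ιMulti R n w))).restrictScalars R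
      ∘ₗ exteriorPower.alternatingMapLinearEquiv (coordDet j) := by
    ext v
    have := (ι.compAlternatingMap (exteriorPower.ιMulti R n)).eq_coordDet_smul hj hw v
    simpa using this
  intro x y hxy
  apply hι
  rw [hfac, LinearMap.comp_apply, LinearMap.comp_apply, hxy]

end CoordDet

section Extension

variable {R : Type*} [CommRing R] [IsDomain R] {K : Type*} [Field K] [Algebra R K]
  [IsFractionRing R K] {P : Type*} [AddCommGroup P] [Module R P]

/-- The ternary form of a quadratic map with respect to three elements: its coefficients are the
values at these elements and the polar form at pairs of them. -/
def QuadraticMap.toTernaryForm (q : QuadraticMap R P K) (w : Fin 3 → P) : TernaryForm K where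
  c11 := q (w 0)
  c22 := q (w 1)
  c33 := q (w 2)
  c12 := QuadraticMap.polar q (w 0) (w 1)
  c13 := QuadraticMap.polar q (w 0) (w 2)
  c23 := QuadraticMap.polar q (w 1) (w 2)

lemma QuadraticMap.eq_eval_toTernaryForm {j : P →ₗ[R] (Fin 3 → K)} (hj : Function.Injective j)
    {w : Fin 3 → P} (hw : ∀ i, j (w i) = Pi.single i 1) (q : QuadraticMap R P K) (x : P) :
    q x = (q.toTernaryForm w).eval (j x) := by
  obtain ⟨d, r, hd, hr⟩ := exists_smul_eq_sum hj hw x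
  have hd0 : algebraMap R K d ≠ 0 := IsFractionRing.to_map_ne_zero_of_mem_nonZeroDivisors d.2
  refine mul_left_cancel₀ (mul_ne_zero hd0 hd0) ?_
  have h := congrArg q hd
  rw [Fin.sum_univ_three, QuadraticMap.map_smul, QuadraticMap.map_add q, QuadraticMap.map_add q,
    QuadraticMap.polar_add_left] at h
  simp only [QuadraticMap.map_smul, QuadraticMap.polar_smul_left, QuadraticMap.polar_smul_right,
    Algebra.smul_def, map_mul, hr] at h
  rw [h]
  simp only [TernaryForm.eval, QuadraticMap.toTernaryForm]
  ring

/-- An alternating form on a module of rank two is decomposable, that is, of the form `u ∧ v`. -/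
lemma exists_linearMap_eq_sub {j : P →ₗ[R] (Fin 2 → K)} (hj : Function.Injective j)
    {w : Fin 2 → P} (hw : ∀ i, j (w i) = Pi.single i 1) (t : ⋀[R]^2 P →ₗ[R] K) :
    ∃ u v : P →ₗ[R] K, ∀ x y, t (exteriorPower.ιMulti R 2 ![x, y]) = u x * v y - u y * v x := by
  refine ⟨(LinearMap.mulLeft R (t (exteriorPower.ιMulti R 2 w))) ∘ₗ LinearMap.proj 0 ∘ₗ j,
    LinearMap.proj 1 ∘ₗ j, fun x y => ?_⟩
  have := (t.compAlternatingMap (exteriorPower.ιMulti R 2)).eq_coordDet_smul hj hw ![x, y]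
  rw [LinearMap.compAlternatingMap_apply, LinearMap.compAlternatingMap_apply] at this
  rw [this, coordDet_apply, Matrix.det_fin_two]
  simp
  ring

end Extension

/-! ### Weights and fractional ideals -/

section WeightIdeal

variable {R : Type*} [CommRing R] [IsDedekindDomain R] {K : Type*} [Field K] [Algebra R K]
  [IsFractionRing R K]

/-- In a Dedekind domain the squares of the elements of an ideal generate its square: products
`x * y` lie in the span of `x ^ 2` and `y ^ 2`. -/
lemma mul_mul_mem_of_sq_mem {I : FractionalIdeal R⁰ K} {J : Submodule R K} {c : K}
    (h : ∀ x ∈ I, c * (x * x) ∈ J) {x y : K} (hx : x ∈ I) (hy : y ∈ I) : c * (x * y) ∈ J := by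
  by_cases hx0 : x = 0
  · simp [hx0]
  -- Write `1 = α * x + β * y` with `α`, `β` in the inverse of the ideal generated by `x`, `y`.
  -- Then `x * y = (α * y) * x ^ 2 + (β * x) * y ^ 2`.
  set L := FractionalIdeal.spanSingleton R⁰ x + FractionalIdeal.spanSingleton R⁰ y with hL
  have hxL : x ∈ L := (FractionalIdeal.mem_add _ _ _).mpr
    ⟨x, FractionalIdeal.mem_spanSingleton_self _ _, 0, FractionalIdeal.zero_mem _, add_zero x⟩
  have hyL : y ∈ L := (FractionalIdeal.mem_add _ _ _).mpr
    ⟨0, FractionalIdeal.zero_mem _, y, FractionalIdeal.mem_spanSingleton_self _ _, zero_add y⟩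
  have hL0 : L ≠ 0 := fun h0 => hx0 (by
    rw [h0] at hxL
    exact (FractionalIdeal.mem_zero_iff _).mp hxL)
  have h1 : (1 : K) ∈ L * L⁻¹ := by
    rw [mul_inv_cancel₀ hL0]
    exact FractionalIdeal.one_mem_one _
  have hint : ∀ α ∈ L⁻¹, ∀ z ∈ L, ∃ r : R, algebraMap R K r = α * z := fun α hα z hz => by
    have := FractionalIdeal.mul_mem_mul hα hz
    rwa [inv_mul_cancel₀ hL0, FractionalIdeal.mem_one_iff] at this
  nth_rewrite 1 [hL] at h1
  rw [add_mul] at h1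
  obtain ⟨p, hp, q, hq, hpq⟩ := (FractionalIdeal.mem_add _ _ _).mp h1
  obtain ⟨α, hα, rfl⟩ := FractionalIdeal.mem_singleton_mul.mp hp
  obtain ⟨β, hβ, rfl⟩ := FractionalIdeal.mem_singleton_mul.mp hq
  obtain ⟨r, hr⟩ := hint α hα y hyL
  obtain ⟨s, hs⟩ := hint β hβ x hxL
  have : c * (x * y) = r • (c * (x * x)) + s • (c * (y * y)) := by
    rw [Algebra.smul_def, Algebra.smul_def, hr, hs]
    linear_combination -c * x * y * hpq
  rw [this]
  exact J.add_mem (J.smul_mem _ (h x hx)) (J.smul_mem _ (h y hy))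

lemma mem_mul_inv_of_forall_mul_mem {I J : FractionalIdeal R⁰ K} (hI : I ≠ 0) {c : K}
    (h : ∀ x ∈ I, c * x ∈ J) : c ∈ J * I⁻¹ := by
  have h1 : FractionalIdeal.spanSingleton R⁰ c * I ≤ J :=
    FractionalIdeal.spanSingleton_mul_le_iff.mpr h
  have h2 : FractionalIdeal.spanSingleton R⁰ c ≤ J * I⁻¹ := by
    calc _ = FractionalIdeal.spanSingleton R⁰ c * I * I⁻¹ := by
          rw [mul_assoc, mul_inv_cancel₀ hI, mul_one]
      _ ≤ _ := mul_le_mul_left h1 _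
  exact h2 (FractionalIdeal.mem_spanSingleton_self _ _)

lemma mem_mul_inv_of_forall_mul_mul_mem {I I' J : FractionalIdeal R⁰ K} (hI : I ≠ 0)
    (hI' : I' ≠ 0) {c : K} (h : ∀ x ∈ I, ∀ y ∈ I', c * (x * y) ∈ J) : c ∈ J * (I * I')⁻¹ := by
  rw [mul_inv, mul_comm I⁻¹, ← mul_assoc]
  refine mem_mul_inv_of_forall_mul_mem hI fun x hx => ?_
  refine mem_mul_inv_of_forall_mul_mem hI' fun y hy => ?_
  rw [mul_assoc]
  exact h x hx y hy

/-- The elements of `K` of weight `(l, m, n)`: the fractional ideal `a₀ˡ a₁ᵐ a₂ⁿ`. The structure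
constants of the order `R ⊕ a₀ ξ₁ ⊕ a₁ ξ₂ ⊕ a₂ ξ₃` have to lie in such ideals. -/
noncomputable def weightIdeal (a : Fin 3 → FractionalIdeal R⁰ K) (l m n : ℤ) : Submodule R K :=
  (a 0 ^ l * a 1 ^ m * a 2 ^ n : FractionalIdeal R⁰ K)

variable {a : Fin 3 → FractionalIdeal R⁰ K}

lemma mul_mem_weightIdeal (ha : ∀ i, a i ≠ 0) {l m n l' m' n' l'' m'' n'' : ℤ} {x y : K}
    (hx : x ∈ weightIdeal a l m n) (hy : y ∈ weightIdeal a l' m' n')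
    (h1 : l + l' = l'' := by norm_num) (h2 : m + m' = m'' := by norm_num)
    (h3 : n + n' = n'' := by norm_num) : x * y ∈ weightIdeal a l'' m'' n'' := by
  subst h1 h2 h3
  have h := FractionalIdeal.mul_mem_mul (show x ∈ a 0 ^ l * a 1 ^ m * a 2 ^ n from hx)
    (show y ∈ a 0 ^ l' * a 1 ^ m' * a 2 ^ n' from hy)
  rw [show a 0 ^ l * a 1 ^ m * a 2 ^ n * (a 0 ^ l' * a 1 ^ m' * a 2 ^ n') =
    a 0 ^ (l + l') * a 1 ^ (m + m') * a 2 ^ (n + n') by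
      simp only [zpow_add₀ (ha _)]; ring] at h
  exact h

lemma mem_weightIdeal_zero {x : K} :
    x ∈ weightIdeal a 0 0 0 ↔ x ∈ (algebraMap R K).range := by
  simp [weightIdeal]

lemma mem_weightIdeal_single {x : K} :
    (x ∈ weightIdeal a 1 0 0 ↔ x ∈ a 0) ∧ (x ∈ weightIdeal a 0 1 0 ↔ x ∈ a 1) ∧
      (x ∈ weightIdeal a 0 0 1 ↔ x ∈ a 2) := by
  simp [weightIdeal]

variable {M : Type*} [AddCommGroup M] [Module R M]

/-- Multiples of `(α, β) : K²` by elements of the ideal of weight `(i, j, k)` behave as if they lay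
in the span of the image of `(u, v) : M → K²`: a linear form on `K²` mapping this image to the ideal
of weight `(l, m, n)` maps `(α, β)` to the ideal of weight `(l - i, m - j, n - k)`. -/
def HasWeight (a : Fin 3 → FractionalIdeal R⁰ K) (u v : M →ₗ[R] K) (α β : K) (i j k : ℤ) :
    Prop :=
  ∀ (c d : K) (l m n : ℤ), (∀ z : M, c * v z - d * u z ∈ weightIdeal a l m n) →
    c * β - d * α ∈ weightIdeal a (l - i) (m - j) (n - k)

lemma HasWeight.minor_mem {u v : M →ₗ[R] K} {α β α' β' : K} {i j k i' j' k' l m n : ℤ}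
    (hW : ∀ y z, u y * v z - u z * v y ∈ weightIdeal a 1 1 1)
    (h : HasWeight a u v α β i j k) (h' : HasWeight a u v α' β' i' j' k')
    (h1 : 1 - i - i' = l := by norm_num) (h2 : 1 - j - j' = m := by norm_num)
    (h3 : 1 - k - k' = n := by norm_num) :
    α * β' - α' * β ∈ weightIdeal a l m n := by
  subst h1 h2 h3
  have := h' α β _ _ _ fun z => by
    have := h (-u z) (-v z) 1 1 1 fun y => by
      convert hW y z using 1
      ring
    convert this using 1
    ring
  rwa [mul_comm β] at this

end WeightIdeal

namespace QuarticAlgebra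

variable {R : Type*} [CommRing R] [IsDedekindDomain R] {K : Type*} [Field K] [Algebra R K]
  [IsFractionRing R K] {A B : TernaryForm K} {a : Fin 3 → FractionalIdeal R⁰ K}
  {M : Type*} [AddCommGroup M] [Module R M]

/-- If the coefficient vectors of the pair `(A, B)` have the weights of the corresponding monomials,
then `sijk` lies in the ideal attached to `ξₖ` divided by those attached to `ξᵢ` and `ξⱼ` (for
`k = 0`, in the inverse of the product of the latter two). So the elements with scalar component in
`R` and each `ξᵢ`-component in its ideal form a subalgebra. -/
theorem exists_subalgebra (ha : ∀ i, a i ≠ 0) {u v : M →ₗ[R] K}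
    (hW : ∀ y z, u y * v z - u z * v y ∈ weightIdeal a 1 1 1)
    (w11 : HasWeight a u v A.c11 B.c11 2 0 0) (w22 : HasWeight a u v A.c22 B.c22 0 2 0)
    (w33 : HasWeight a u v A.c33 B.c33 0 0 2) (w12 : HasWeight a u v A.c12 B.c12 1 1 0)
    (w13 : HasWeight a u v A.c13 B.c13 1 0 1) (w23 : HasWeight a u v A.c23 B.c23 0 1 1) :
    ∃ S : Subalgebra R (QuarticAlgebra A B), ∀ p, p ∈ S ↔
      p.x0 ∈ (algebraMap R K).range ∧ p.x1 ∈ a 0 ∧ p.x2 ∈ a 1 ∧ p.x3 ∈ a 2 := by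
  have c111 : s111 A B ∈ weightIdeal a (-1) 0 0 :=
    add_mem (w12.minor_mem hW w13) (w11.minor_mem hW w23)
  have c112 : s112 A B ∈ weightIdeal a (-2) 1 0 := neg_mem (w11.minor_mem hW w13)
  have c113 : s113 A B ∈ weightIdeal a (-2) 0 1 := w11.minor_mem hW w12
  have c221 : s221 A B ∈ weightIdeal a 1 (-2) 0 := w22.minor_mem hW w23
  have c222 : s222 A B ∈ weightIdeal a 0 (-1) 0 :=
    add_mem (neg_mem (w22.minor_mem hW w13)) (w23.minor_mem hW w12)
  have c223 : s223 A B ∈ weightIdeal a 0 (-2) 1 := neg_mem (w22.minor_mem hW w12)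
  have c331 : s331 A B ∈ weightIdeal a 1 0 (-2) := neg_mem (w33.minor_mem hW w23)
  have c332 : s332 A B ∈ weightIdeal a 0 1 (-2) := w33.minor_mem hW w13
  have c333 : s333 A B ∈ weightIdeal a 0 0 (-1) :=
    add_mem (w33.minor_mem hW w12) (w13.minor_mem hW w23)
  have c123 : s123 A B ∈ weightIdeal a (-1) (-1) 1 := w11.minor_mem hW w22
  have c132 : s132 A B ∈ weightIdeal a (-1) 1 (-1) := w33.minor_mem hW w11
  have c133 : s133 A B ∈ weightIdeal a (-1) 0 0 := w11.minor_mem hW w23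
  have c231 : s231 A B ∈ weightIdeal a 1 (-1) (-1) := w22.minor_mem hW w33
  have c232 : s232 A B ∈ weightIdeal a 0 0 (-1) := w33.minor_mem hW w12
  have c233 : s233 A B ∈ weightIdeal a 0 (-1) 0 := neg_mem (w22.minor_mem hW w13)
  have c110 : s110 A B ∈ weightIdeal a (-2) 0 0 :=
    sub_mem (mul_mem_weightIdeal ha c123 c132)
      (add_mem (mul_mem_weightIdeal ha c112 c222) (mul_mem_weightIdeal ha c113 c232))
  have c220 : s220 A B ∈ weightIdeal a 0 (-2) 0 :=
    sub_mem (mul_mem_weightIdeal ha c123 c231) (mul_mem_weightIdeal ha c221 c111)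
  have c330 : s330 A B ∈ weightIdeal a 0 0 (-2) :=
    sub_mem (add_mem (mul_mem_weightIdeal ha c132 c231) (mul_mem_weightIdeal ha c133 c331))
      (mul_mem_weightIdeal ha c331 c111)
  have c120 : s120 A B ∈ weightIdeal a (-1) (-1) 0 :=
    sub_mem (add_mem (add_mem (mul_mem_weightIdeal ha c231 c113)
      (mul_mem_weightIdeal ha c232 c123)) (mul_mem_weightIdeal ha c233 c133))
      (mul_mem_weightIdeal ha c123 c333)
  have c130 : s130 A B ∈ weightIdeal a (-1) 0 (-1) :=
    sub_mem (add_mem (mul_mem_weightIdeal ha c231 c112) (mul_mem_weightIdeal ha c233 c132))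
      (add_mem (mul_mem_weightIdeal ha c132 c222) (mul_mem_weightIdeal ha c133 c232))
  have c230 : s230 A B ∈ weightIdeal a 0 (-1) (-1) :=
    sub_mem (add_mem (mul_mem_weightIdeal ha c132 c221) (mul_mem_weightIdeal ha c133 c231))
      (mul_mem_weightIdeal ha c231 c111)
  simp only [← mem_weightIdeal_zero (a := a), ← (mem_weightIdeal_single (a := a)).1,
    ← (mem_weightIdeal_single (a := a)).2.1, ← (mem_weightIdeal_single (a := a)).2.2]
  refine ⟨
    { carrier := {p | p.x0 ∈ weightIdeal a 0 0 0 ∧ p.x1 ∈ weightIdeal a 1 0 0 ∧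
        p.x2 ∈ weightIdeal a 0 1 0 ∧ p.x3 ∈ weightIdeal a 0 0 1}
      mul_mem' := ?_
      add_mem' := fun {p q} hp hq => ⟨add_mem hp.1 hq.1, add_mem hp.2.1 hq.2.1,
        add_mem hp.2.2.1 hq.2.2.1, add_mem hp.2.2.2 hq.2.2.2⟩
      algebraMap_mem' := fun r => ⟨mem_weightIdeal_zero.mpr ⟨r, rfl⟩, zero_mem _, zero_mem _,
        zero_mem _⟩ }, fun p => Iff.rfl⟩
  rintro p q ⟨p0, p1, p2, p3⟩ ⟨q0, q1, q2, q3⟩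
  have m11 := mul_mem_weightIdeal ha p1 q1 rfl rfl rfl
  have m22 := mul_mem_weightIdeal ha p2 q2 rfl rfl rfl
  have m33 := mul_mem_weightIdeal ha p3 q3 rfl rfl rfl
  have m12 : _ ∈ weightIdeal a 1 1 0 :=
    add_mem (mul_mem_weightIdeal ha p1 q2) (mul_mem_weightIdeal ha p2 q1)
  have m13 : _ ∈ weightIdeal a 1 0 1 :=
    add_mem (mul_mem_weightIdeal ha p1 q3) (mul_mem_weightIdeal ha p3 q1)
  have m23 : _ ∈ weightIdeal a 0 1 1 :=
    add_mem (mul_mem_weightIdeal ha p2 q3) (mul_mem_weightIdeal ha p3 q2)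
  refine ⟨?_, ?_, ?_, ?_⟩
  · rw [x0_mul]
    repeat' apply add_mem
    all_goals
      first
      | exact mul_mem_weightIdeal ha p0 q0
      | exact mul_mem_weightIdeal ha m11 c110
      | exact mul_mem_weightIdeal ha m22 c220
      | exact mul_mem_weightIdeal ha m33 c330
      | exact mul_mem_weightIdeal ha m12 c120
      | exact mul_mem_weightIdeal ha m13 c130
      | exact mul_mem_weightIdeal ha m23 c230
  · rw [x1_mul]
    repeat' apply add_mem
    all_goals
      first
      | exact mul_mem_weightIdeal ha p0 q1
      | exact mul_mem_weightIdeal ha p1 q0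
      | exact mul_mem_weightIdeal ha m11 c111
      | exact mul_mem_weightIdeal ha m22 c221
      | exact mul_mem_weightIdeal ha m33 c331
      | exact mul_mem_weightIdeal ha m23 c231
  · rw [x2_mul]
    repeat' apply add_mem
    all_goals
      first
      | exact mul_mem_weightIdeal ha p0 q2
      | exact mul_mem_weightIdeal ha p2 q0
      | exact mul_mem_weightIdeal ha m11 c112
      | exact mul_mem_weightIdeal ha m22 c222
      | exact mul_mem_weightIdeal ha m33 c332
      | exact mul_mem_weightIdeal ha m13 c132
      | exact mul_mem_weightIdeal ha m23 c232
  · rw [x3_mul]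
    repeat' apply add_mem
    all_goals
      first
      | exact mul_mem_weightIdeal ha p0 q3
      | exact mul_mem_weightIdeal ha p3 q0
      | exact mul_mem_weightIdeal ha m11 c113
      | exact mul_mem_weightIdeal ha m22 c223
      | exact mul_mem_weightIdeal ha m33 c333
      | exact mul_mem_weightIdeal ha m12 c123
      | exact mul_mem_weightIdeal ha m13 c133
      | exact mul_mem_weightIdeal ha m23 c233

end QuarticAlgebra

/-! ### The order over a lattice -/

section Weights

variable {R : Type*} [CommRing R] [IsDedekindDomain R] {K : Type*} [Field K] [Algebra R K]
  [IsFractionRing R K] {a : Fin 3 → FractionalIdeal R⁰ K} {M : Type*} [AddCommGroup M] [Module R M]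

lemma HasWeight.of_mul (ha : ∀ i, a i ≠ 0) {u v : M →ₗ[R] K} {α β : K} {i j k : ℤ} (p q : Fin 3)
    (hpq : a p * a q = a 0 ^ i * a 1 ^ j * a 2 ^ k)
    (h : ∀ x ∈ a p, ∀ y ∈ a q, ∃ z, u z = x * y * α ∧ v z = x * y * β) :
    HasWeight a u v α β i j k := by
  intro c d l m n hz
  have hmem : c * β - d * α ∈ a 0 ^ l * a 1 ^ m * a 2 ^ n * (a p * a q)⁻¹ := by
    refine mem_mul_inv_of_forall_mul_mul_mem (ha p) (ha q) fun x hx y hy => ?_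
    obtain ⟨z, hu, hv⟩ := h x hx y hy
    have : c * v z - d * u z ∈ a 0 ^ l * a 1 ^ m * a 2 ^ n := hz z
    rw [hu, hv] at this
    convert this using 1
    ring
  rwa [hpq, show a 0 ^ l * a 1 ^ m * a 2 ^ n * (a 0 ^ i * a 1 ^ j * a 2 ^ k)⁻¹ =
    a 0 ^ (l - i) * a 1 ^ (m - j) * a 2 ^ (n - k) by
      simp only [zpow_sub₀ (ha _), mul_inv, div_eq_mul_inv]; ring] at hmem

/-- The diagonal coefficients of a quadratic map are seen only through multiples by squares. -/
lemma HasWeight.of_sq (ha : ∀ i, a i ≠ 0) {u v : M →ₗ[R] K} {α β : K} {i j k : ℤ} (p : Fin 3)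
    (hp : a p * a p = a 0 ^ i * a 1 ^ j * a 2 ^ k)
    (h : ∀ x ∈ a p, ∃ z, u z = x * x * α ∧ v z = x * x * β) : HasWeight a u v α β i j k := by
  intro c d l m n hz
  have hmem : c * β - d * α ∈ a 0 ^ l * a 1 ^ m * a 2 ^ n * (a p * a p)⁻¹ := by
    refine mem_mul_inv_of_forall_mul_mul_mem (ha p) (ha p) fun x hx y hy => ?_
    refine mul_mul_mem_of_sq_mem (I := a p) (J := weightIdeal a l m n) (fun x hx => ?_) hx hy
    obtain ⟨z, hu, hv⟩ := h x hx
    have := hz z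
    rw [hu, hv] at this
    convert this using 1
    ring
  rwa [hp, show a 0 ^ l * a 1 ^ m * a 2 ^ n * (a 0 ^ i * a 1 ^ j * a 2 ^ k)⁻¹ =
    a 0 ^ (l - i) * a 1 ^ (m - j) * a 2 ^ (n - k) by
      simp only [zpow_sub₀ (ha _), mul_inv, div_eq_mul_inv]; ring] at hmem

end Weights

namespace QuarticAlgebra

variable {R : Type*} [CommRing R] [IsDedekindDomain R] {K : Type*} [Field K] [Algebra R K]
  [IsFractionRing R K] {a : Fin 3 → FractionalIdeal R⁰ K}
  {M : Type*} [AddCommGroup M] [Module R M] {P : Type*} [AddCommGroup P] [Module R P]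

/-- The order in `QuarticAlgebra A B` over the lattice `P`, when `(A, B)` extends `φ`, seen through
an alternating form `u ∧ v` on `M` with values in the determinant ideal of `P`. -/
theorem exists_order {j : P →ₗ[R] (Fin 3 → K)}
    (ha : ∀ i, a i ≠ 0) (hr : ∀ v, v ∈ LinearMap.range j ↔ ∀ i, v i ∈ a i)
    (φ : QuadraticMap R P M) {u v : M →ₗ[R] K} {A B : TernaryForm K}
    (hA : ∀ x, u (φ x) = A.eval (j x)) (hB : ∀ x, v (φ x) = B.eval (j x))
    (hW : ∀ y z, u y * v z - u z * v y ∈ weightIdeal a 1 1 1) :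
    ∃ S : Subalgebra R (QuarticAlgebra A B), ∀ p, p ∈ S ↔
      p.x0 ∈ (algebraMap R K).range ∧ coords p ∈ LinearMap.range j := by
  have hlift : ∀ i, ∀ x ∈ a i, ∃ z, j z = Pi.single i x := fun i x hx =>
    (hr _).mpr fun k => by
      by_cases hk : k = i
      · subst hk; simpa using hx
      · simpa [hk] using FractionalIdeal.zero_mem _
  have hsq : ∀ i, ∀ x ∈ a i, ∃ z, u z = A.eval (Pi.single i x) ∧ v z = B.eval (Pi.single i x) :=
    fun i x hx => by
      obtain ⟨z, hz⟩ := hlift i x hx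
      exact ⟨φ z, by rw [hA, hz], by rw [hB, hz]⟩
  have hmul : ∀ i k, ∀ x ∈ a i, ∀ y ∈ a k, ∃ z,
      u z = A.eval (Pi.single i x + Pi.single k y) - A.eval (Pi.single i x)
        - A.eval (Pi.single k y) ∧
      v z = B.eval (Pi.single i x + Pi.single k y) - B.eval (Pi.single i x)
        - B.eval (Pi.single k y) := fun i k x hx y hy => by
      obtain ⟨z, hz⟩ := hlift i x hx
      obtain ⟨z', hz'⟩ := hlift k y hy
      exact ⟨φ (z + z') - φ z - φ z', by simp only [map_sub, hA, map_add, hz, hz'],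
        by simp only [map_sub, hB, map_add, hz, hz']⟩
  have w11 : HasWeight a u v A.c11 B.c11 2 0 0 :=
    .of_sq ha 0 (by simp [zpow_ofNat, pow_two]) fun x hx => by
      obtain ⟨z, h1, h2⟩ := hsq 0 x hx
      exact ⟨z, by simp [h1, TernaryForm.eval]; ring, by simp [h2, TernaryForm.eval]; ring⟩
  have w22 : HasWeight a u v A.c22 B.c22 0 2 0 :=
    .of_sq ha 1 (by simp [zpow_ofNat, pow_two]) fun x hx => by
      obtain ⟨z, h1, h2⟩ := hsq 1 x hx
      exact ⟨z, by simp [h1, TernaryForm.eval]; ring, by simp [h2, TernaryForm.eval]; ring⟩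
  have w33 : HasWeight a u v A.c33 B.c33 0 0 2 :=
    .of_sq ha 2 (by simp [zpow_ofNat, pow_two]) fun x hx => by
      obtain ⟨z, h1, h2⟩ := hsq 2 x hx
      exact ⟨z, by simp [h1, TernaryForm.eval]; ring, by simp [h2, TernaryForm.eval]; ring⟩
  have w12 : HasWeight a u v A.c12 B.c12 1 1 0 :=
    .of_mul ha 0 1 (by simp) fun x hx y hy => by
      obtain ⟨z, h1, h2⟩ := hmul 0 1 x hx y hy
      exact ⟨z, by simp [h1, TernaryForm.eval]; ring, by simp [h2, TernaryForm.eval]; ring⟩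
  have w13 : HasWeight a u v A.c13 B.c13 1 0 1 :=
    .of_mul ha 0 2 (by simp) fun x hx y hy => by
      obtain ⟨z, h1, h2⟩ := hmul 0 2 x hx y hy
      exact ⟨z, by simp [h1, TernaryForm.eval]; ring, by simp [h2, TernaryForm.eval]; ring⟩
  have w23 : HasWeight a u v A.c23 B.c23 0 1 1 :=
    .of_mul ha 1 2 (by simp) fun x hx y hy => by
      obtain ⟨z, h1, h2⟩ := hmul 1 2 x hx y hy
      exact ⟨z, by simp [h1, TernaryForm.eval]; ring, by simp [h2, TernaryForm.eval]; ring⟩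
  obtain ⟨S, hS⟩ := exists_subalgebra ha hW w11 w22 w33 w12 w13 w23
  refine ⟨S, fun p => ?_⟩
  rw [hS, hr, Fin.forall_fin_succ, Fin.forall_fin_two]
  rfl

end QuarticAlgebra

/-- The determinant takes the top exterior power of `⨁ aᵢ` into the product of the `aᵢ`. -/
lemma coordDet_lift_mem_weightIdeal {R : Type*} [CommRing R] [IsDedekindDomain R] {K : Type*}
    [Field K] [Algebra R K] [IsFractionRing R K] {a : Fin 3 → FractionalIdeal R⁰ K}
    {P : Type*} [AddCommGroup P] [Module R P] {j : P →ₗ[R] (Fin 3 → K)} (ha : ∀ i, a i ≠ 0)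
    (hr : ∀ v, v ∈ LinearMap.range j ↔ ∀ i, v i ∈ a i) (t : ⋀[R]^3 P) :
    exteriorPower.alternatingMapLinearEquiv (coordDet j) t ∈ weightIdeal a 1 1 1 := by
  have hspan : t ∈ Submodule.span R (Set.range (exteriorPower.ιMulti R 3 (M := P))) := by
    rw [exteriorPower.ιMulti_span]; trivial
  induction hspan using Submodule.span_induction with
  | zero => simp
  | add x y _ _ hx hy => rw [map_add]; exact add_mem hx hy
  | smul r x _ hx => rw [map_smul]; exact Submodule.smul_mem _ r hx
  | mem x hx =>
    obtain ⟨v, rfl⟩ := hx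
    rw [exteriorPower.alternatingMapLinearEquiv_apply_ιMulti, coordDet_apply,
      Matrix.det_fin_three]
    have h0 : ∀ i, j (v i) 0 ∈ weightIdeal a 1 0 0 := fun i =>
      mem_weightIdeal_single.1.mpr ((hr _).mp ⟨v i, rfl⟩ 0)
    have h1 : ∀ i, j (v i) 1 ∈ weightIdeal a 0 1 0 := fun i =>
      mem_weightIdeal_single.2.1.mpr ((hr _).mp ⟨v i, rfl⟩ 1)
    have h2 : ∀ i, j (v i) 2 ∈ weightIdeal a 0 0 1 := fun i =>
      mem_weightIdeal_single.2.2.mpr ((hr _).mp ⟨v i, rfl⟩ 2)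
    have h : ∀ i k l, j (v i) 0 * j (v k) 1 * j (v l) 2 ∈ weightIdeal a 1 1 1 := fun i k l =>
      mul_mem_weightIdeal ha (mul_mem_weightIdeal ha (h0 i) (h1 k) rfl rfl rfl) (h2 l)
    simp only [Matrix.of_apply]
    convert add_mem (sub_mem (add_mem (add_mem (sub_mem (h 0 1 2) (h 0 2 1))
      (neg_mem (h 1 0 2))) (h 2 0 1)) (neg_mem (h 1 2 0))) (neg_mem (h 2 1 0)) using 1
    ring

/-! ### Quartic algebras with a given resolvent -/

lemma IsQuarticAlgebra.of_surjective {R : Type*} [CommRing R] [IsDedekindDomain R]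
    {P : Type*} [AddCommGroup P] [Module R P] (hP : IsLatticeOfRank R P 3)
    {S : Type*} [CommRing S] [Algebra R S] (hinj : Function.Injective (algebraMap R S))
    (g : S →ₗ[R] P) (hg : Function.Surjective g)
    (hker : LinearMap.ker g = LinearMap.range (Algebra.linearMap R S)) :
    IsQuarticAlgebra R S := by
  have := hP.finite
  have := hP.torsionFree
  let e := LinearEquiv.ofInjective (Algebra.linearMap R S) hinj
  let e' := (Submodule.quotEquivOfEq _ _ hker.symm).trans (g.quotKerEquivOfSurjective hg)
  have : Module.Finite R (LinearMap.range (Algebra.linearMap R S)) := Module.Finite.equiv e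
  have : Module.Finite R (S ⧸ LinearMap.range (Algebra.linearMap R S)) :=
    Module.Finite.equiv e'.symm
  have hfin : Module.Finite R S :=
    Module.Finite.of_submodule_quotient (LinearMap.range (Algebra.linearMap R S))
  refine ⟨hfin, ?_, ?_⟩
  · refine .of_smul_eq_zero fun r s hrs => ?_
    by_cases hr : r = 0
    · exact Or.inl hr
    have h1 : g s = 0 := by
      have := congrArg g hrs
      rw [map_smul, map_zero] at this
      exact (smul_eq_zero.mp this).resolve_left hr
    obtain ⟨c, rfl⟩ : s ∈ LinearMap.range (Algebra.linearMap R S) := hker ▸ h1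
    rw [← map_smul, Algebra.linearMap_apply, map_eq_zero_iff _ hinj, smul_eq_mul] at hrs
    rw [(mul_eq_zero.mp hrs).resolve_left hr, map_zero]
    exact Or.inr rfl
  · have h1 := Submodule.finrank_quotient_add_finrank (LinearMap.range (Algebra.linearMap R S))
    rw [e'.finrank_eq, ← e.finrank_eq, hP.finrank_eq, Module.finrank_self] at h1
    exact h1.symm

/-- A criterion for `(M, θ, φ)` to be a resolvent in terms of a presentation of `S` as an extension
of `P` by `R`. -/
lemma exists_equiv_isQuarticAlgebraWithResolvent {R : Type*} [CommRing R] [IsDedekindDomain R]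
    {P : Type*} [AddCommGroup P] [Module R P] (hP : IsLatticeOfRank R P 3)
    {M : Type*} [AddCommGroup M] [Module R M] (hM : IsLatticeOfRank R M 2)
    {θ : ⋀[R]^2 M →ₗ[R] ⋀[R]^3 P} {φ : QuadraticMap R P M}
    {S : Type*} [CommRing S] [Algebra R S] (hinj : Function.Injective (algebraMap R S))
    (g : S →ₗ[R] P) (hg : Function.Surjective g)
    (hker : LinearMap.ker g = LinearMap.range (Algebra.linearMap R S))
    (hθ : ∀ x y, exteriorPower.ιMulti R 3 ![g x, g y, g (x * y)] =
      θ (exteriorPower.ιMulti R 2 ![φ (g x), φ (g y)])) :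
    ∃ e : ModScalars R S ≃ₗ[R] P, (∀ s, e (ModScalars.mk R s) = g s) ∧
      IsQuarticAlgebraWithResolvent θ φ S e := by
  let e : ModScalars R S ≃ₗ[R] P :=
    (Submodule.quotEquivOfEq _ _ hker.symm).trans (g.quotKerEquivOfSurjective hg)
  have he : ∀ s, e (ModScalars.mk R s) = g s := fun s => rfl
  refine ⟨e, he, IsQuarticAlgebra.of_surjective hP hinj g hg hker, hM, fun x y => ?_⟩
  have hs : ∀ s, e.symm (g s) = ModScalars.mk R s := fun s => by
    rw [← he, LinearEquiv.symm_apply_apply]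
  have h2 : ![(φ.comp (e : ModScalars R S →ₗ[R] P)) (ModScalars.mk R x),
      (φ.comp (e : ModScalars R S →ₗ[R] P)) (ModScalars.mk R y)] = ![φ (g x), φ (g y)] := rfl
  rw [h2, LinearMap.comp_apply, ← hθ, exteriorPower.map_apply_ιMulti]
  congr 1
  ext i
  fin_cases i <;> simp [hs]

/-- The resolvent identity, transported to the lattice `P`. -/
lemma IsQuarticAlgebraWithResolvent.ιMulti_eq {R : Type*} [CommRing R]
    {P : Type*} [AddCommGroup P] [Module R P] {M : Type*} [AddCommGroup M] [Module R M]
    {θ : ⋀[R]^2 M →ₗ[R] ⋀[R]^3 P} {φ : QuadraticMap R P M}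
    {S : Type*} [CommRing S] [Algebra R S] {e : ModScalars R S ≃ₗ[R] P}
    (h : IsQuarticAlgebraWithResolvent θ φ S e) (x y : S) :
    exteriorPower.ιMulti R 3 ![e (ModScalars.mk R x), e (ModScalars.mk R y),
      e (ModScalars.mk R (x * y))] =
      θ (exteriorPower.ιMulti R 2 ![φ (e (ModScalars.mk R x)), φ (e (ModScalars.mk R y))]) := by
  have h1 := congrArg (exteriorPower.map 3 (e : ModScalars R S →ₗ[R] P))
    (h.isResolvent.wedge_eq x y)
  rw [exteriorPower.map_apply_ιMulti, LinearMap.comp_apply, ← LinearMap.comp_apply,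
    ← exteriorPower.map_comp, LinearEquiv.comp_symm, exteriorPower.map_id, LinearMap.id_apply]
    at h1
  have h2 : (e : ModScalars R S →ₗ[R] P) ∘ ![ModScalars.mk R x, ModScalars.mk R y,
      ModScalars.mk R (x * y)] = ![e (ModScalars.mk R x), e (ModScalars.mk R y),
      e (ModScalars.mk R (x * y))] := by
    ext i
    fin_cases i <;> rfl
  rw [h2] at h1
  exact h1

open TensorProduct in
lemma exists_smul_eq_one_tmul {R : Type*} [CommRing R] {K : Type*} [Field K]
    [Algebra R K] [IsFractionRing R K] {N : Type*} [AddCommGroup N] [Module R N] (t : K ⊗[R] N) :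
    ∃ (d : R⁰) (s : N), algebraMap R K d • t = 1 ⊗ₜ s := by
  induction t using TensorProduct.induction_on with
  | zero => exact ⟨1, 0, by simp⟩
  | tmul k s =>
    obtain ⟨⟨r, d⟩, hr⟩ := IsLocalization.surj R⁰ k
    refine ⟨d, r • s, ?_⟩
    rw [TensorProduct.smul_tmul', smul_eq_mul, mul_comm, hr, TensorProduct.tmul_smul,
      TensorProduct.smul_tmul', Algebra.smul_def, mul_one]
  | add t t' h h' =>
    obtain ⟨d, s, hs⟩ := h
    obtain ⟨d', s', hs'⟩ := h'
    refine ⟨d * d', (d' : R) • s + (d : R) • s', ?_⟩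
    rw [Submonoid.coe_mul, map_mul, smul_add, mul_smul, mul_smul, hs', smul_comm, hs,
      TensorProduct.tmul_add, TensorProduct.tmul_smul, TensorProduct.tmul_smul,
      algebraMap_smul, algebraMap_smul]

namespace QuarticAlgebra

variable {R : Type*} [CommRing R] [IsDedekindDomain R] {K : Type*} [Field K] [Algebra R K]
  [IsFractionRing R K]

open TensorProduct in
/-- The resolvent identity on `S` passes to `K ⊗ S` by clearing denominators, as both sides are
homogeneous of degree two in each variable; so `QuarticAlgebra A B` maps to `K ⊗ S`. -/
lemma exists_algHom_baseChange {P : Type*} [AddCommGroup P] [Module R P]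
    {j : P →ₗ[R] (Fin 3 → K)} (hj : Function.Injective j) {w : Fin 3 → P}
    (hw : ∀ i, j (w i) = Pi.single i 1) {A B : TernaryForm K}
    {S : Type*} [CommRing S] [Algebra R S] (e : ModScalars R S ≃ₗ[R] P)
    (hdet : ∀ x y : S, (Matrix.of ![j (e (ModScalars.mk R x)), j (e (ModScalars.mk R y)),
      j (e (ModScalars.mk R (x * y)))]).det =
      A.eval (j (e (ModScalars.mk R x))) * B.eval (j (e (ModScalars.mk R y))) -
        A.eval (j (e (ModScalars.mk R y))) * B.eval (j (e (ModScalars.mk R x)))) :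
    ∃ (π : K ⊗[R] S →ₗ[K] (Fin 3 → K)) (ψ : QuarticAlgebra A B →ₐ[K] K ⊗[R] S),
      (∀ s : S, π (1 ⊗ₜ s) = j (e (ModScalars.mk R s))) ∧
      (∀ t, π t = 0 → ∃ k, algebraMap K (K ⊗[R] S) k = t) ∧ ∀ p, π (ψ p) = coords p := by
  let g : S →ₗ[R] (Fin 3 → K) := j ∘ₗ e.toLinearMap ∘ₗ Submodule.mkQ _
  have hgj : ∀ s, g s = j (e (ModScalars.mk R s)) := fun s => rfl
  simp only [← hgj] at hdet ⊢
  let π : K ⊗[R] S →ₗ[K] (Fin 3 → K) := LinearMap.liftBaseChange K g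
  have hπ : ∀ s : S, π (1 ⊗ₜ s) = g s := fun s => by simp [π]
  have hone : π 1 = 0 := by
    have h1 : ModScalars.mk R (1 : S) = 0 :=
      (Submodule.Quotient.mk_eq_zero _).mpr ⟨1, map_one (algebraMap R S)⟩
    rw [Algebra.TensorProduct.one_def, hπ, hgj, h1, map_zero, map_zero]
  have hker : ∀ t, π t = 0 → ∃ k, algebraMap K (K ⊗[R] S) k = t := fun t ht => by
    obtain ⟨d, s, hs⟩ := exists_smul_eq_one_tmul t
    have hd0 : algebraMap R K d ≠ 0 := IsFractionRing.to_map_ne_zero_of_mem_nonZeroDivisors d.2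
    have h1 : g s = 0 := by rw [← hπ, ← hs, map_smul, ht, smul_zero]
    have h2 : ModScalars.mk R s = 0 := by
      apply e.injective
      apply hj
      rw [← hgj, h1, map_zero, map_zero]
    obtain ⟨r, rfl⟩ := (Submodule.Quotient.mk_eq_zero _).mp h2
    refine ⟨(algebraMap R K d)⁻¹ * algebraMap R K r, ?_⟩
    refine smul_right_injective _ hd0 ?_
    simp only
    rw [hs, Algebra.smul_def, ← map_mul, mul_inv_cancel_left₀ hd0, Algebra.linearMap_apply,
      ← Algebra.TensorProduct.includeRight_apply, AlgHom.commutes,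
      ← IsScalarTower.algebraMap_apply]
  have hsurj : Function.Surjective π := fun v => by
    choose s hs using fun i => Submodule.Quotient.mk_surjective _ (e.symm (w i))
    refine ⟨∑ i, v i • (1 ⊗ₜ s i), ?_⟩
    have h1 : ∀ i, g (s i) = Pi.single i 1 := fun i => by
      rw [hgj, ModScalars.mk, hs, LinearEquiv.apply_symm_apply, hw]
    simp only [map_sum, map_smul, hπ, h1]
    ext i
    simp [Finset.sum_apply, Pi.single_apply]
  have hdetT : ∀ x y, (Matrix.of ![π x, π y, π (x * y)]).det =
      A.eval (π x) * B.eval (π y) - A.eval (π y) * B.eval (π x) := fun x y => by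
    obtain ⟨d, s, hs⟩ := exists_smul_eq_one_tmul x
    obtain ⟨d', s', hs'⟩ := exists_smul_eq_one_tmul y
    have hd0 : algebraMap R K d ≠ 0 := IsFractionRing.to_map_ne_zero_of_mem_nonZeroDivisors d.2
    have hd0' : algebraMap R K d' ≠ 0 :=
      IsFractionRing.to_map_ne_zero_of_mem_nonZeroDivisors d'.2
    have h1 : g s = algebraMap R K d • π x := by rw [← hπ, ← hs, map_smul]
    have h2 : g s' = algebraMap R K d' • π y := by rw [← hπ, ← hs', map_smul]
    have h3 : g (s * s') = (algebraMap R K d * algebraMap R K d') • π (x * y) := by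
      rw [← hπ, ← map_smul, ← smul_mul_smul_comm, hs, hs', Algebra.TensorProduct.tmul_mul_tmul,
        one_mul]
    have h := hdet s s'
    rw [h1, h2, h3] at h
    simp only [TernaryForm.eval_smul, Matrix.det_fin_three] at h ⊢
    generalize algebraMap R K d = δ at h hd0
    generalize algebraMap R K d' = δ' at h hd0'
    simp at h ⊢
    refine mul_left_cancel₀ (mul_ne_zero (mul_ne_zero hd0 hd0) (mul_ne_zero hd0' hd0')) ?_
    linear_combination h
  obtain ⟨ψ, hψ⟩ := exists_algHom (A := A) (B := B) π hker hone hsurj hdetT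
  exact ⟨π, ψ, hπ, hker, hψ⟩

end QuarticAlgebra

/-! ### Uniqueness of the order -/

namespace QuarticAlgebra

variable {R : Type*} [CommRing R] [IsDedekindDomain R] {K : Type*} [Field K] [Algebra R K]
  [IsFractionRing R K]

open TensorProduct in
/-- Two quartic orders over the same lattice agree: two lifts of an element of the lattice which are
both integral differ by an integral element of `K`, hence by an element of `R`. -/
lemma exists_algEquiv {P : Type*} [AddCommGroup P] [Module R P]
    {j : P →ₗ[R] (Fin 3 → K)} (hj : Function.Injective j) {A B : TernaryForm K}
    {Q : Type*} [CommRing Q] [Algebra R Q] [Algebra.IsIntegral R Q]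
    (i : Q →ₐ[R] QuarticAlgebra A B) (hi : Function.Injective i)
    (e : ModScalars R Q ≃ₗ[R] P) (he : ∀ q, j (e (ModScalars.mk R q)) = coords (i q))
    {S : Type*} [CommRing S] [Algebra R S] [Algebra.IsIntegral R S] [Module.Flat R S]
    [Nontrivial (K ⊗[R] S)]
    (e' : ModScalars R S ≃ₗ[R] P)
    {π : K ⊗[R] S →ₗ[K] (Fin 3 → K)} {ψ : QuarticAlgebra A B →ₐ[K] K ⊗[R] S}
    (hπ : ∀ s : S, π (1 ⊗ₜ s) = j (e' (ModScalars.mk R s)))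
    (hker : ∀ t, π t = 0 → ∃ k, algebraMap K (K ⊗[R] S) k = t)
    (hψ : ∀ p, π (ψ p) = coords p) :
    ∃ f : Q ≃ₐ[R] S, ∀ q : Q, e' (ModScalars.mk R (f q)) = e (ModScalars.mk R q) := by
  let α : Q →ₐ[R] K ⊗[R] S := (ψ.restrictScalars R).comp i
  let β : S →ₐ[R] K ⊗[R] S := Algebra.TensorProduct.includeRight
  have hα : Function.Injective α := by
    suffices hψi : Function.Injective ψ from hψi.comp hi
    rw [injective_iff_map_eq_zero]
    intro p hp
    have h1 := hψ p
    rw [hp, map_zero, coords_apply] at h1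
    have h2 : p = algebraMap K _ p.x0 := by
      ext
      · simp
      · exact (congrFun h1 0).symm
      · exact (congrFun h1 1).symm
      · exact (congrFun h1 2).symm
    rw [h2, AlgHom.commutes, map_eq_zero_iff _ (algebraMap K (K ⊗[R] S)).injective] at hp
    rw [h2, hp, map_zero]
  have hβ : Function.Injective β :=
    Algebra.TensorProduct.includeRight_injective (FaithfulSMul.algebraMap_injective R K)
  have hπα : ∀ q, π (α q) = j (e (ModScalars.mk R q)) := fun q => by rw [he]; exact hψ _
  have hπβ : ∀ s, π (β s) = j (e' (ModScalars.mk R s)) := hπ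
  have hdiff : ∀ q s, e (ModScalars.mk R q) = e' (ModScalars.mk R s) →
      ∃ r : R, α q = β s + algebraMap R _ r := fun q s hqs => by
    obtain ⟨k, hk⟩ := hker (α q - β s) (by rw [map_sub, hπα, hπβ, hqs, sub_self])
    have hint : IsIntegral R (algebraMap K (K ⊗[R] S) k) := by
      rw [hk]
      exact ((Algebra.IsIntegral.isIntegral q).map α).sub
        ((Algebra.IsIntegral.isIntegral s).map β)
    rw [isIntegral_algebraMap_iff (algebraMap K (K ⊗[R] S)).injective] at hint
    obtain ⟨r, rfl⟩ := IsIntegrallyClosed.isIntegral_iff.mp hint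
    refine ⟨r, ?_⟩
    rw [IsScalarTower.algebraMap_apply R K, hk]
    ring
  have hrange : α.range = β.range := by
    apply le_antisymm
    · rintro _ ⟨q, rfl⟩
      obtain ⟨s, hs⟩ := Submodule.Quotient.mk_surjective _ (e'.symm (e (ModScalars.mk R q)))
      obtain ⟨r, hr⟩ := hdiff q s (by rw [ModScalars.mk, ModScalars.mk, hs, e'.apply_symm_apply])
      refine ⟨s + algebraMap R S r, ?_⟩
      change β _ = α q
      rw [map_add, AlgHom.commutes, hr]
    · rintro _ ⟨s, rfl⟩
      obtain ⟨q, hq⟩ := Submodule.Quotient.mk_surjective _ (e.symm (e' (ModScalars.mk R s)))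
      obtain ⟨r, hr⟩ := hdiff q s (by rw [ModScalars.mk, ModScalars.mk, hq, e.apply_symm_apply])
      refine ⟨q - algebraMap R Q r, ?_⟩
      change α _ = β s
      rw [map_sub, AlgHom.commutes, hr, add_sub_cancel_right]
  let f : Q ≃ₐ[R] S := (AlgEquiv.ofInjective α hα).trans
    ((Subalgebra.equivOfEq _ _ hrange).trans (AlgEquiv.ofInjective β hβ).symm)
  have hf : ∀ q, β (f q) = α q := fun q => by
    have := congrArg Subtype.val ((AlgEquiv.ofInjective β hβ).apply_symm_apply
      (Subalgebra.equivOfEq _ _ hrange (AlgEquiv.ofInjective α hα q)))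
    exact this
  exact ⟨f, fun q => hj (by rw [← hπβ, hf, hπα])⟩

end QuarticAlgebra

/-! ### Existence and uniqueness -/

/-- Existence of a quartic algebra `Q` with an isomorphism `e : Q / R ≃ Q'` for which `(M, θ, φ)`
is a resolvent, and uniqueness of the pair `(Q, e)` up to isomorphism (in every universe). -/
theorem theorem7p2 (R : Type u) [CommRing R] [IsDedekindDomain R]
    (Q' : Type v) [AddCommGroup Q'] [Module R Q'] (hQ' : IsLatticeOfRank R Q' 3)
    (M : Type w) [AddCommGroup M] [Module R M] (hM : IsLatticeOfRank R M 2)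
    (θ : ⋀[R]^2 M →ₗ[R] ⋀[R]^3 Q') (φ : QuadraticMap R Q' M) :
    ∃ (Q : Type (max u v)) (_ : CommRing Q) (_ : Algebra R Q) (e : ModScalars R Q ≃ₗ[R] Q'),
      IsQuarticAlgebraWithResolvent θ φ Q e ∧
      ∀ (S : Type x) [CommRing S] [Algebra R S] (e' : ModScalars R S ≃ₗ[R] Q'),
        IsQuarticAlgebraWithResolvent θ φ S e' →
          ∃ f : Q ≃ₐ[R] S, ∀ q : Q,
            e' (ModScalars.mk R (f q)) = e (ModScalars.mk R q) := by
  classical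
  let K := FractionRing R
  have := hQ'.finite
  have := hQ'.projective
  obtain ⟨j, a, hj, ha1, hr⟩ := hQ'.exists_coordinates K
  have ha : ∀ i, a i ≠ 0 := fun i h0 => one_ne_zero (α := K) <| by
    have := ha1 i
    rwa [h0, FractionalIdeal.mem_zero_iff] at this
  obtain ⟨jM, b, hjM, hb1, hrM⟩ := hM.exists_coordinates K
  have hw : ∀ i, ∃ w, j w = Pi.single i 1 := fun i => (hr _).mpr fun k => by
    by_cases hk : k = i
    · subst hk; simpa using ha1 k
    · simpa [hk] using FractionalIdeal.zero_mem _
  have hwM : ∀ i, ∃ w, jM w = Pi.single i 1 := fun i => (hrM _).mpr fun k => by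
    by_cases hk : k = i
    · subst hk; simpa using hb1 k
    · simpa [hk] using FractionalIdeal.zero_mem _
  choose w hw using hw
  choose wM hwM using hwM
  let D := exteriorPower.alternatingMapLinearEquiv (coordDet j)
  have hD : Function.Injective D := coordDet_lift_injective hj hw
  obtain ⟨u, v, huv⟩ := exists_linearMap_eq_sub hjM hwM (D ∘ₗ θ)
  let A := (u.compQuadraticMap φ).toTernaryForm w
  let B := (v.compQuadraticMap φ).toTernaryForm w
  have hA : ∀ x, u (φ x) = A.eval (j x) := fun x =>
    (u.compQuadraticMap φ).eq_eval_toTernaryForm hj hw x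
  have hB : ∀ x, v (φ x) = B.eval (j x) := fun x =>
    (v.compQuadraticMap φ).eq_eval_toTernaryForm hj hw x
  have hDι : ∀ x y z, D (exteriorPower.ιMulti R 3 ![x, y, z]) =
      (Matrix.of ![j x, j y, j z]).det := fun x y z => by
    rw [exteriorPower.alternatingMapLinearEquiv_apply_ιMulti, coordDet_apply]
    congr 2
    ext i
    fin_cases i <;> rfl
  have hDθ : ∀ x y, D (θ (exteriorPower.ιMulti R 2 ![φ x, φ y])) =
      A.eval (j x) * B.eval (j y) - A.eval (j y) * B.eval (j x) := fun x y => by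
    rw [← hA, ← hA, ← hB, ← hB]
    exact huv _ _
  obtain ⟨Q, hQ⟩ := QuarticAlgebra.exists_order ha hr φ hA hB fun y z => by
    rw [← huv]
    exact coordDet_lift_mem_weightIdeal ha hr _
  -- The order lives in the universe of `R`, hence the lift.
  let i : ULift.{v} Q →ₐ[R] QuarticAlgebra A B := Q.val.comp ULift.algEquiv.toAlgHom
  have hi : Function.Injective i := Subtype.val_injective.comp ULift.down_injective
  have hirange : ∀ p, p ∈ Set.range i ↔
      p.x0 ∈ (algebraMap R K).range ∧ QuarticAlgebra.coords p ∈ LinearMap.range j := fun p =>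
    ⟨fun ⟨q, hq⟩ => hq ▸ (hQ _).mp q.down.2, fun hp => ⟨⟨⟨p, (hQ p).mpr hp⟩⟩, rfl⟩⟩
  let g : ULift.{v} Q →ₗ[R] Q' := (LinearEquiv.ofInjective j hj).symm.toLinearMap ∘ₗ
    LinearMap.codRestrict (LinearMap.range j)
      ((QuarticAlgebra.coords.restrictScalars R) ∘ₗ i.toLinearMap)
      (fun q => ((hirange _).mp ⟨q, rfl⟩).2)
  have hg : ∀ q, j (g q) = QuarticAlgebra.coords (i q) := fun q =>
    congrArg Subtype.val ((LinearEquiv.ofInjective j hj).apply_symm_apply _)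
  have hinj : Function.Injective (algebraMap R (ULift.{v} Q)) := fun r s hrs => by
    have h := congrArg (fun q => (i q).x0) hrs
    simp only [AlgHom.commutes, QuarticAlgebra.x0_algebraMap] at h
    exact IsFractionRing.injective R K h
  have hgsurj : Function.Surjective g := fun x => by
    obtain ⟨q, hq⟩ := (hirange ⟨0, j x 0, j x 1, j x 2⟩).mpr ⟨zero_mem _, x, by
      ext k; fin_cases k <;> rfl⟩
    refine ⟨q, hj ?_⟩
    rw [hg, hq]
    ext k; fin_cases k <;> rfl
  have hgker : LinearMap.ker g = LinearMap.range (Algebra.linearMap R (ULift.{v} Q)) := by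
    ext q
    constructor
    · intro hq
      have h1 := hg q
      rw [LinearMap.mem_ker.mp hq, map_zero, QuarticAlgebra.coords_apply] at h1
      obtain ⟨r, hr⟩ := ((hirange (i q)).mp ⟨q, rfl⟩).1
      refine ⟨r, hi ?_⟩
      rw [Algebra.linearMap_apply, AlgHom.commutes]
      ext
      · exact hr
      · exact congrFun h1 0
      · exact congrFun h1 1
      · exact congrFun h1 2
    · rintro ⟨r, rfl⟩
      refine LinearMap.mem_ker.mpr (hj ?_)
      rw [hg, Algebra.linearMap_apply, AlgHom.commutes, map_zero]
      ext k; fin_cases k <;> rfl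
  obtain ⟨e, he, hres⟩ := exists_equiv_isQuarticAlgebraWithResolvent hQ' hM hinj g hgsurj hgker
    (θ := θ) (φ := φ) fun x y => hD (by
      rw [hDι, hDθ, hg, hg, hg, map_mul, QuarticAlgebra.det_coords_mul])
  refine ⟨ULift.{v} Q, inferInstance, inferInstance, e, hres, fun S _ _ e' hS => ?_⟩
  obtain ⟨π, ψ, hπ, hker, hψ⟩ := QuarticAlgebra.exists_algHom_baseChange (A := A) (B := B) hj hw e'
    fun x y => by rw [← hDι, hS.ιMulti_eq, hDθ]
  have := hres.isQuartic.finite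
  have := hS.isQuartic.finite
  have := hS.isQuartic.torsionFree
  have hSn : Nontrivial S :=
    Module.nontrivial_of_finrank_pos (R := R) (by rw [hS.isQuartic.finrank_eq]; norm_num)
  have : Nontrivial (TensorProduct R K S) :=
    (Algebra.TensorProduct.includeRight_injective (R := R) (A := K) (B := S)
      (FaithfulSMul.algebraMap_injective R K)).nontrivial
  exact QuarticAlgebra.exists_algEquiv hj i hi e (fun q => by rw [he, hg]) e' hπ hker hψ
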